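/- Let $(V,Y,\mathbf 1,\omega)$ be a simple vertex operator algebra over $\mathbb C$ (that is, $V\neq 0$ is irreducible as a module over itself), let $g$ be an automorphism of $V$ of finite order $K$, and put $V^r=\{v\in V: gv=e^{2\pi i r/K}v\}$; thus $V^0$ is the vertex operator subalgebra of $g$-fixed points. Let $M=\coprod_{\lambda\in\mathbb C}M_\lambda$ be a simple $g$-twisted $V$-module, where $M_\lambda$ is the $\lambda$-eigenspace of $L(0)$, all $M_\lambda$ are finite dimensional, for each $\lambda$ one has $M_{\lambda+n}=0$ for $n\in\mathbb Z$ sufficiently small, and $Y_M(v,z)=\sum_{n\in r/K+\mathbb Z}v_nz^{-n-1}$ for $v\in V^r$. Then: 1. $M$ has a unique minimal weight $\lambda$, i.e. a unique $\lambda\in\mathbb C$ such that $M_\lambda\ne0$ and $M_{\lambda-k/K}=0$ for all integers $k\geq 1$. There is a unique linear action of $\langle g\rangle$ on $M$ (i.e. an operator, again written $g$, with $g^K=1$ on $M$) such that $g\,Y_M(v,z)\,g^{-1}=Y_M(gv,z)$ for all $v\in V$ and such that its eigenspaces $M^r=\{m\in M: gm=e^{2\pi i r/K}m\}$ are $M^r=\bigoplus_{n\in\mathbb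 Z}M_{\lambda-\frac rK+n}$ for all $r\in\mathbb Z$. 2. For this action, and more generally for every action of $\langle g\rangle$ on $M$ with $g\,Y_M(v,z)\,g^{-1}=Y_M(gv,z)$ for all $v\in V$, let $M=M^0\oplus M^1\oplus\cdots\oplus M^{K-1}$ be the decomposition into the eigenspaces $M^r=\{m\in M: gm=e^{2\pi i r/K}m\}$. Then every $M^r$ ($0\le r\le K-1$) is nonzero and, under the restricted operators $v_n$ with $v\in V^0$, is a simple (untwisted) $V^0$-module, and the $V^0$-modules $M^0,\dots,M^{K-1}$ are pairwise non-isomorphic. -/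

import Mathlib

noncomputable section

/-- A vertex operator algebra structure on a complex vector space `V`.
For `u : V` the vertex operator is `Y(u,z) = ∑ₙ uₙ z^(-n-1)`, where
`uₙ = VertexOperator.ncoeff (Y u) n`; that `uₙ v = 0` for `n` large is part of the type
`VertexOperator`.  The operators `L(n) = ω_(n+1)` are the modes of the conformal vector.
The homogeneous subspace `V_n` of the grading is the eigenspace of `L(0)` for `n`
(as is forced by the axiom `L(0) v = n v` for `v ∈ V_n`). -/
structure VertexOperatorAlgebra (V : Type*) [AddCommGroup V] [Module ℂ V] where
  /-- the state-field correspondence -/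
  Y : V →ₗ[ℂ] VertexOperator ℂ V
  /-- the vacuum vector -/
  vac : V
  /-- the conformal vector -/
  ω : V
  /-- the rank (central charge) -/
  rank : ℂ
  /-- `V = ⨁_{n ∈ ℤ} V_n` -/
  grading : DirectSum.IsInternal fun n : ℤ =>
    Module.End.eigenspace (VertexOperator.ncoeff (Y ω) 1) (n : ℂ)
  finite_dim : ∀ n : ℤ,
    FiniteDimensional ℂ (Module.End.eigenspace (VertexOperator.ncoeff (Y ω) 1) (n : ℂ))
  bounded_below : ∃ N : ℤ, ∀ n : ℤ, n < N →
    Module.End.eigenspace (VertexOperator.ncoeff (Y ω) 1) (n : ℂ) = ⊥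
  vac_mem : vac ∈ Module.End.eigenspace (VertexOperator.ncoeff (Y ω) 1) 0
  ω_mem : ω ∈ Module.End.eigenspace (VertexOperator.ncoeff (Y ω) 1) 2
  /-- `Y(𝟏,z) = 1` -/
  vacuum : ∀ (n : ℤ) (v : V), VertexOperator.ncoeff (Y vac) n v = if n = -1 then v else 0
  /-- `Y(v,z)𝟏` has no negative powers of `z` ... -/
  creation_regular : ∀ (v : V) (n : ℤ), 0 ≤ n → VertexOperator.ncoeff (Y v) n vac = 0
  /-- ... and its constant term is `v`. -/
  creation : ∀ v : V, VertexOperator.ncoeff (Y v) (-1) vac = v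
  /-- The Jacobi identity: coefficient of `z₀^(-p-1) z₁^(-s-1) z₂^(-t-1)`.
  By truncation all the sums are finite. -/
  jacobi : ∀ (u v w : V) (p s t : ℤ),
    (∑ᶠ m : ℕ, ((-1 : ℂ) ^ m * ((Ring.choose p m : ℤ) : ℂ)) •
      (VertexOperator.ncoeff (Y u) (p + s - m) (VertexOperator.ncoeff (Y v) (t + m) w)
        - (-1 : ℂ) ^ p •
          VertexOperator.ncoeff (Y v) (p + t - m) (VertexOperator.ncoeff (Y u) (s + m) w)))
    = ∑ᶠ m : ℕ, ((Ring.choose s m : ℤ) : ℂ) •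
        VertexOperator.ncoeff (Y (VertexOperator.ncoeff (Y u) (p + m) v)) (s + t - m) w
  /-- `[L(m), L(n)] = (m - n) L(m+n) + (m³ - m)/12 δ_{m+n,0} rank V` -/
  virasoro : ∀ (m n : ℤ) (v : V),
    VertexOperator.ncoeff (Y ω) (m + 1) (VertexOperator.ncoeff (Y ω) (n + 1) v)
      - VertexOperator.ncoeff (Y ω) (n + 1) (VertexOperator.ncoeff (Y ω) (m + 1) v)
    = ((m : ℂ) - n) • VertexOperator.ncoeff (Y ω) (m + n + 1) v
      + (if m + n = 0 then ((m : ℂ) ^ 3 - m) / 12 * rank else 0) • v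
  /-- `d/dz Y(v,z) = Y(L(-1)v,z)` -/
  derivative : ∀ (v : V) (n : ℤ) (w : V),
    VertexOperator.ncoeff (Y (VertexOperator.ncoeff (Y ω) 0 v)) n w
      = (-(n : ℂ)) • VertexOperator.ncoeff (Y v) (n - 1) w

namespace VertexOperatorAlgebra

variable {V : Type*} [AddCommGroup V] [Module ℂ V]

/-- The operator `uₙ` on `V`, the coefficient of `z^(-n-1)` in `Y(u,z)`. -/
def mode (𝒱 : VertexOperatorAlgebra V) (u : V) (n : ℤ) : Module.End ℂ V :=
  VertexOperator.ncoeff (𝒱.Y u) n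

/-- `V` is simple: it is nonzero and irreducible as a module over itself. -/
def IsSimple (𝒱 : VertexOperatorAlgebra V) : Prop :=
  Nontrivial V ∧ ∀ W : Submodule ℂ V,
    (∀ (u : V) (n : ℤ), ∀ w ∈ W, 𝒱.mode u n w ∈ W) → W = ⊥ ∨ W = ⊤

/-- The group of automorphisms of a vertex operator algebra. -/
def Aut (𝒱 : VertexOperatorAlgebra V) : Subgroup (V ≃ₗ[ℂ] V) where
  carrier := {g | g 𝒱.vac = 𝒱.vac ∧ g 𝒱.ω = 𝒱.ω ∧
    ∀ (u : V) (n : ℤ) (v : V), g (𝒱.mode u n v) = 𝒱.mode (g u) n (g v)}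
  one_mem' := ⟨rfl, rfl, fun _ _ _ => rfl⟩
  mul_mem' := by
    rintro a b ⟨ha1, ha2, ha3⟩ ⟨hb1, hb2, hb3⟩
    refine ⟨?_, ?_, fun u n v => ?_⟩
    · rw [LinearEquiv.mul_apply, hb1, ha1]
    · rw [LinearEquiv.mul_apply, hb2, ha2]
    · rw [LinearEquiv.mul_apply, hb3, ha3]; rfl
  inv_mem' := by
    rintro a ⟨ha1, ha2, ha3⟩
    refine ⟨?_, ?_, fun u n v => ?_⟩
    · exact (LinearEquiv.symm_apply_eq a).2 ha1.symm
    · exact (LinearEquiv.symm_apply_eq a).2 ha2.symm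
    · refine (LinearEquiv.symm_apply_eq a).2 ?_
      rw [ha3]
      congr 1
      · exact congrArg (fun x => 𝒱.mode x n) (LinearEquiv.apply_symm_apply a u).symm
      · exact (LinearEquiv.apply_symm_apply a v).symm

variable {𝒱 : VertexOperatorAlgebra V}

/-- For `g` of finite order `K`, the eigenspace `V^r = {v | g v = e^(2πir/K) v}`. -/
def twistedPart (g : 𝒱.Aut) (r : ℤ) : Submodule ℂ V :=
  Module.End.eigenspace ((g : V ≃ₗ[ℂ] V) : Module.End ℂ V)
    (Complex.exp (2 * Real.pi * Complex.I * r / (orderOf g : ℂ)))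

/-- The space `V^0` of fixed points of `g`. -/
def fixedSpace (g : 𝒱.Aut) : Submodule ℂ V where
  carrier := {v | (g : V ≃ₗ[ℂ] V) v = v}
  add_mem' := by intro a b ha hb; exact (map_add _ a b).trans (congrArg₂ _ ha hb)
  zero_mem' := map_zero _
  smul_mem' := by intro c a ha; exact (map_smul _ c a).trans (congrArg _ ha)

theorem mem_fixedSpace {g : 𝒱.Aut} {v : V} :
    v ∈ fixedSpace g ↔ (g : V ≃ₗ[ℂ] V) v = v := Iff.rfl

theorem fixedSpace_le_twistedPart (g : 𝒱.Aut) : fixedSpace g ≤ twistedPart g 0 := by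
  intro v hv
  rw [twistedPart, Module.End.mem_eigenspace_iff]
  simpa using mem_fixedSpace.1 hv

theorem mode_mem_fixedSpace {g : 𝒱.Aut} {u v : V} (hu : u ∈ fixedSpace g)
    (hv : v ∈ fixedSpace g) (n : ℤ) : 𝒱.mode u n v ∈ fixedSpace g := by
  rw [mem_fixedSpace] at *
  rw [g.2.2.2, hu, hv]

end VertexOperatorAlgebra

/-- If `f` is diagonalizable and preserves `W`, so is its restriction to `W`. -/
theorem iSup_eigenspace_restrict_eq_top {M : Type*} [AddCommGroup M] [Module ℂ M]
    (f : Module.End ℂ M) (W : Submodule ℂ M) (hW : ∀ x ∈ W, f x ∈ W)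
    (hf : ⨆ lam : ℂ, Module.End.eigenspace f lam = ⊤) :
    ⨆ lam : ℂ, Module.End.eigenspace (f.restrict hW) lam = ⊤ := by
  classical
  have key : ∀ (s : Finset ℂ) (x : ℂ → M), (∀ a, x a ∈ Module.End.eigenspace f a) →
      ∑ a ∈ s, x a ∈ W → ∀ a ∈ s, x a ∈ W := by
    intro s
    induction s using Finset.induction_on with
    | empty => intro x _ _ a ha; simp at ha
    | insert b s hb ih =>
      intro x hx hsum
      have hs : ∀ a ∈ s, x a ∈ W := by
        have h1 := ih (fun a => (a - b) • x a)
          (fun a => Submodule.smul_mem _ _ (hx a)) (by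
            have h2 := W.sub_mem (hW _ hsum) (W.smul_mem b hsum)
            rw [map_sum, Finset.smul_sum, ← Finset.sum_sub_distrib,
              Finset.sum_insert hb] at h2
            have h3 : ∀ a, f (x a) - b • x a = (a - b) • x a := fun a => by
              rw [Module.End.mem_eigenspace_iff.1 (hx a), sub_smul]
            simpa [h3] using h2)
        intro a ha
        have hab : a - b ≠ 0 := sub_ne_zero.2 (fun h => hb (h ▸ ha))
        exact (W.smul_mem_iff hab).1 (h1 a ha)
      intro a ha
      rcases Finset.mem_insert.1 ha with rfl | ha
      · rw [Finset.sum_insert hb] at hsum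
        exact (W.add_mem_iff_left (W.sum_mem hs)).1 hsum
      · exact hs a ha
  rw [eq_top_iff]
  rintro ⟨w, hw⟩ -
  have hw' : w ∈ ⨆ lam : ℂ, Module.End.eigenspace f lam := hf ▸ Submodule.mem_top
  obtain ⟨x, hx, hxw⟩ := (Submodule.mem_iSup_iff_exists_finsupp _ _).1 hw'
  have hxW := key x.support x hx (by rw [Finsupp.sum] at hxw; rw [hxw]; exact hw)
  have : (⟨w, hw⟩ : W) = ∑ a ∈ x.support.attach, ⟨x a, hxW a a.2⟩ := by
    apply Subtype.ext
    rw [AddSubmonoidClass.coe_finsetSum]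
    simp only
    rw [Finset.sum_attach x.support (fun a => x a), ← hxw]
    rfl
  rw [this]
  refine Submodule.sum_mem _ fun a _ => Submodule.mem_iSup_of_mem (a : ℂ) ?_
  rw [Module.End.mem_eigenspace_iff]
  apply Subtype.ext
  exact Module.End.mem_eigenspace_iff.1 (hx a)

theorem mem_eigenspace_restrict {M : Type*} [AddCommGroup M] [Module ℂ M]
    {f : Module.End ℂ M} {W : Submodule ℂ M} {hW : ∀ x ∈ W, f x ∈ W} {lam : ℂ} {x : W} :
    x ∈ Module.End.eigenspace (f.restrict hW) lam ↔
      (x : M) ∈ Module.End.eigenspace f lam := by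
  rw [Module.End.mem_eigenspace_iff, Module.End.mem_eigenspace_iff, Subtype.ext_iff]
  rfl

theorem finiteDimensional_eigenspace_restrict {M : Type*} [AddCommGroup M] [Module ℂ M]
    (f : Module.End ℂ M) (W : Submodule ℂ M) (hW : ∀ x ∈ W, f x ∈ W) (lam : ℂ)
    (h : FiniteDimensional ℂ (Module.End.eigenspace f lam)) :
    FiniteDimensional ℂ (Module.End.eigenspace (f.restrict hW) lam) := by
  refine Module.Finite.of_injective
    ((W.subtype.comp (Submodule.subtype _)).codRestrict (Module.End.eigenspace f lam)
      (fun x => mem_eigenspace_restrict.1 x.2)) ?_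
  intro x y hxy
  have h' : ((x : W) : M) = ((y : W) : M) :=
    congrArg (fun z : Module.End.eigenspace f lam => (z : M)) hxy
  exact Subtype.ext (Subtype.ext h')

theorem eigenspace_restrict_bot {M : Type*} [AddCommGroup M] [Module ℂ M]
    (f : Module.End ℂ M) (W : Submodule ℂ M) (hW : ∀ x ∈ W, f x ∈ W) (lam : ℂ)
    (h : Module.End.eigenspace f lam = ⊥) :
    Module.End.eigenspace (f.restrict hW) lam = ⊥ := by
  rw [eq_bot_iff]
  intro x hx
  have := mem_eigenspace_restrict.1 hx
  rw [h, Submodule.mem_bot] at this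
  exact (Submodule.mem_bot ℂ).2 (Subtype.ext this)

theorem coe_finsum_submodule {M : Type*} [AddCommGroup M] [Module ℂ M] (W : Submodule ℂ M)
    (f : ℕ → W) : ((∑ᶠ m, f m : W) : M) = ∑ᶠ m, (f m : M) :=
  W.subtype.toAddMonoidHom.map_finsum_of_injective Subtype.val_injective f

namespace VertexOperatorAlgebra

variable {V : Type*} [AddCommGroup V] [Module ℂ V] {𝒱 : VertexOperatorAlgebra V}

/-- The vertex operators `Y(u,z)`, `u ∈ V^0`, restricted to `V^0`. -/
def fixedY (g : 𝒱.Aut) : fixedSpace g →ₗ[ℂ] VertexOperator ℂ (fixedSpace g) where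
  toFun u := HVertexOperator.of_coeff
    (fun n => (𝒱.mode u (-n - 1)).restrict fun _ hv => mode_mem_fixedSpace u.2 hv _)
    (fun v => by
      refine (HVertexOperator.coeff_isPWOsupport (𝒱.Y u) v).mono fun n hn h => hn ?_
      apply Subtype.ext
      change 𝒱.mode u (-n - 1) v = 0
      rw [mode, VertexOperator.ncoeff_apply, show -(-n - 1) - 1 = n by ring]
      exact h)
  map_add' a b := by
    apply HVertexOperator.coeff_inj
    rw [map_add]
    simp only [HVertexOperator.coeff_of_coeff]
    funext n; ext v
    simp [mode]
  map_smul' c a := by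
    apply HVertexOperator.coeff_inj
    rw [RingHom.id_apply, map_smul]
    simp only [HVertexOperator.coeff_of_coeff]
    funext n; ext v
    simp [mode]

theorem ncoeff_fixedY (g : 𝒱.Aut) (u : fixedSpace g) (n : ℤ) :
    VertexOperator.ncoeff (fixedY g u) n =
      (VertexOperator.ncoeff (𝒱.Y u) n).restrict
        fun _ hv => mode_mem_fixedSpace u.2 hv n := by
  rw [VertexOperator.ncoeff_apply]
  change HVertexOperator.coeff (HVertexOperator.of_coeff _ _) (-n - 1) = _
  rw [HVertexOperator.coeff_of_coeff]
  ext v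
  change 𝒱.mode u (-(-n - 1) - 1) v = VertexOperator.ncoeff (𝒱.Y u) n v
  rw [mode, show -(-n - 1) - 1 = n by ring]

@[simp]
theorem coe_ncoeff_fixedY (g : 𝒱.Aut) (u : fixedSpace g) (n : ℤ) (v : fixedSpace g) :
    ((VertexOperator.ncoeff (fixedY g u) n v : fixedSpace g) : V) =
      VertexOperator.ncoeff (𝒱.Y u) n v := by
  rw [ncoeff_fixedY]; rfl

/-- The fixed-point subalgebra `V^0` of an automorphism `g`, as a vertex operator algebra with
the restricted vertex operators and the same vacuum and conformal vectors. -/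
def fixedPoints (𝒱 : VertexOperatorAlgebra V) (g : 𝒱.Aut) :
    VertexOperatorAlgebra (fixedSpace g) where
  Y := fixedY g
  vac := ⟨𝒱.vac, g.2.1⟩
  ω := ⟨𝒱.ω, g.2.2.1⟩
  rank := 𝒱.rank
  grading := by
    rw [DirectSum.isInternal_submodule_iff_iSupIndep_and_iSup_eq_top]
    constructor
    · exact (Module.End.eigenspaces_iSupIndep _).comp Int.cast_injective
    · rw [ncoeff_fixedY]
      have hV := ((DirectSum.isInternal_submodule_iff_iSupIndep_and_iSup_eq_top _).1
        𝒱.grading).2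
      have htop : ⨆ lam : ℂ, Module.End.eigenspace
          (VertexOperator.ncoeff (𝒱.Y 𝒱.ω) 1) lam = ⊤ := by
        rw [eq_top_iff, ← hV]
        exact iSup_le fun n => le_iSup (fun lam : ℂ => Module.End.eigenspace
          (VertexOperator.ncoeff (𝒱.Y 𝒱.ω) 1) lam) (n : ℂ)
      have h := iSup_eigenspace_restrict_eq_top _ (fixedSpace g)
        (fun _ hv => mode_mem_fixedSpace (u := 𝒱.ω) g.2.2.1 hv 1) htop
      rw [eq_top_iff, ← h]
      refine iSup_le fun lam => ?_
      by_cases hl : ∃ n : ℤ, (n : ℂ) = lam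
      · obtain ⟨n, rfl⟩ := hl
        exact le_iSup (fun n : ℤ => Module.End.eigenspace
          (LinearMap.restrict (VertexOperator.ncoeff (𝒱.Y 𝒱.ω) 1) _) (n : ℂ)) n
      · refine le_trans (le_of_eq (eigenspace_restrict_bot _ _ _ _ ?_)) bot_le
        have hind := Module.End.eigenspaces_iSupIndep (VertexOperator.ncoeff (𝒱.Y 𝒱.ω) 1)
        have hd := hind lam
        rw [eq_bot_iff]
        refine hd le_rfl (le_trans le_top (hV ▸ iSup_le fun n => ?_))
        exact le_iSup₂_of_le (n : ℂ) (fun h => hl ⟨n, h⟩) le_rfl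
  finite_dim n := by
    rw [ncoeff_fixedY]
    exact finiteDimensional_eigenspace_restrict _ _ _ _ (𝒱.finite_dim n)
  bounded_below := by
    obtain ⟨N, hN⟩ := 𝒱.bounded_below
    refine ⟨N, fun n hn => ?_⟩
    rw [ncoeff_fixedY]
    exact eigenspace_restrict_bot _ _ _ _ (hN n hn)
  vac_mem := by
    rw [ncoeff_fixedY]; exact mem_eigenspace_restrict.2 𝒱.vac_mem
  ω_mem := by
    rw [ncoeff_fixedY]; exact mem_eigenspace_restrict.2 𝒱.ω_mem
  vacuum n v := by
    apply Subtype.ext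
    rw [coe_ncoeff_fixedY, 𝒱.vacuum]
    split_ifs <;> rfl
  creation_regular v n hn := by
    apply Subtype.ext
    rw [coe_ncoeff_fixedY]
    exact 𝒱.creation_regular v n hn
  creation v := by
    apply Subtype.ext
    rw [coe_ncoeff_fixedY]
    exact 𝒱.creation v
  jacobi u v w p s t := by
    apply Subtype.ext
    rw [coe_finsum_submodule, coe_finsum_submodule]
    simpa using 𝒱.jacobi u v w p s t
  virasoro m n v := by
    apply Subtype.ext
    rw [Submodule.coe_sub, Submodule.coe_add, Submodule.coe_smul, Submodule.coe_smul]
    simp only [coe_ncoeff_fixedY]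
    exact 𝒱.virasoro m n v
  derivative v n w := by
    apply Subtype.ext
    simpa using 𝒱.derivative v n w

end VertexOperatorAlgebra

open VertexOperatorAlgebra

/-- A `g`-twisted module structure on a complex vector space `M`, for an automorphism `g` of
finite order `K = orderOf g` of a vertex operator algebra.
The vertex operators are `Y_M(v,z) = ∑_{n ∈ ℚ} vₙ z^(-n-1)`, with `vₙ = Y v n`, and
`L(n) = ω_(n+1)`.  The homogeneous subspace `M_λ` is the eigenspace of `L(0)` for `λ`
(as is forced by the axiom `L(0) w = λ w` for `w ∈ M_λ`).
An (untwisted) module is the case `g = 1`. -/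
structure TwistedModule {V : Type*} [AddCommGroup V] [Module ℂ V]
    (𝒱 : VertexOperatorAlgebra V) (g : 𝒱.Aut) (M : Type*) [AddCommGroup M] [Module ℂ M] where
  /-- the operators `vₙ` -/
  Y : V →ₗ[ℂ] (ℚ → Module.End ℂ M)
  /-- `M = ⨁_{λ ∈ ℂ} M_λ` -/
  grading : DirectSum.IsInternal fun lam : ℂ => Module.End.eigenspace (Y 𝒱.ω 1) lam
  finite_dim : ∀ lam : ℂ, FiniteDimensional ℂ (Module.End.eigenspace (Y 𝒱.ω 1) lam)
  bounded_below : ∀ lam : ℂ, ∃ N : ℤ, ∀ n : ℤ, n < N →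
    Module.End.eigenspace (Y 𝒱.ω 1) (lam + n) = ⊥
  /-- for `v ∈ V^r` only the modes `vₙ` with `n ∈ r/K + ℤ` occur -/
  mode_support : ∀ (r : ℤ), ∀ v ∈ twistedPart g r, ∀ n : ℚ,
    (¬ ∃ k : ℤ, n = r / (orderOf g : ℚ) + k) → Y v n = 0
  truncation : ∀ (v : V) (w : M), ∃ N : ℚ, ∀ l : ℚ, N < l → Y v l w = 0
  /-- `Y_M(𝟏,z) = 1` -/
  vacuum : ∀ (n : ℚ) (w : M), Y 𝒱.vac n w = if n = -1 then w else 0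
  /-- The twisted Jacobi identity for `u ∈ V^r`: coefficient of
  `z₀^(-p-1) z₁^(-s-1) z₂^(-t-1)`.  Only `s ∈ r/K + ℤ` occurs on either side,
  and by truncation all the sums are finite. -/
  jacobi : ∀ (r : ℤ), ∀ u ∈ twistedPart g r, ∀ (v : V) (w : M) (p : ℤ) (s t : ℚ),
    (∃ k : ℤ, s = r / (orderOf g : ℚ) + k) →
    (∑ᶠ m : ℕ, ((-1 : ℂ) ^ m * ((Ring.choose p m : ℤ) : ℂ)) •
      (Y u (p + s - m) (Y v (t + m) w) - (-1 : ℂ) ^ p • Y v (p + t - m) (Y u (s + m) w)))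
    = ∑ᶠ m : ℕ, ((Ring.choose s m : ℚ) : ℂ) • Y (𝒱.mode u (p + m) v) (s + t - m) w
  /-- `[L(m), L(n)] = (m - n) L(m+n) + (m³ - m)/12 δ_{m+n,0} rank V` -/
  virasoro : ∀ (m n : ℤ) (w : M),
    Y 𝒱.ω (m + 1) (Y 𝒱.ω (n + 1) w) - Y 𝒱.ω (n + 1) (Y 𝒱.ω (m + 1) w)
    = ((m : ℂ) - n) • Y 𝒱.ω (m + n + 1) w
      + (if m + n = 0 then ((m : ℂ) ^ 3 - m) / 12 * 𝒱.rank else 0) • w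
  /-- `d/dz Y_M(v,z) = Y_M(L(-1)v,z)` -/
  derivative : ∀ (v : V) (n : ℚ) (w : M),
    Y (𝒱.mode 𝒱.ω 0 v) n w = (-(n : ℂ)) • Y v (n - 1) w

namespace TwistedModule

variable {V : Type*} [AddCommGroup V] [Module ℂ V] {𝒱 : VertexOperatorAlgebra V} {g : 𝒱.Aut}
  {M : Type*} [AddCommGroup M] [Module ℂ M]

/-- The weight space `M_λ`. -/
def wt (ℳ : TwistedModule 𝒱 g M) (lam : ℂ) : Submodule ℂ M :=
  Module.End.eigenspace (ℳ.Y 𝒱.ω 1) lam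

/-- A twisted module is simple if it is nonzero and has no proper nonzero submodule. -/
def IsSimple (ℳ : TwistedModule 𝒱 g M) : Prop :=
  Nontrivial M ∧ ∀ W : Submodule ℂ M,
    (∀ (u : V) (n : ℚ), ∀ w ∈ W, ℳ.Y u n w ∈ W) → W = ⊥ ∨ W = ⊤

/-- Two `g`-twisted modules are isomorphic: there is a linear isomorphism commuting with all
the operators `vₙ`. -/
def Isomorphic (ℳ : TwistedModule 𝒱 g M) {N : Type*} [AddCommGroup N] [Module ℂ N]
    (𝒩 : TwistedModule 𝒱 g N) : Prop :=
  ∃ φ : M ≃ₗ[ℂ] N, ∀ (v : V) (n : ℚ) (w : M), φ (ℳ.Y v n w) = 𝒩.Y v n (φ w)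

/-- `λ` is a minimal weight: `M_λ ≠ 0`, and no weight `μ ≠ λ` satisfies
`λ - μ ∈ (1/K) ℕ`. -/
def IsMinimalWeight (ℳ : TwistedModule 𝒱 g M) (lam : ℂ) : Prop :=
  ℳ.wt lam ≠ ⊥ ∧ ∀ k : ℕ, 0 < k → ℳ.wt (lam - k / (orderOf g : ℂ)) = ⊥

/-- An action of `g` on `M` compatible with the action of `g` on `V`: an operator `σ` with
`σ^K = 1` and `σ Y_M(v,z) σ⁻¹ = Y_M(gv,z)`. -/
structure IsCompatibleAction (ℳ : TwistedModule 𝒱 g M) (σ : Module.End ℂ M) : Prop where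
  pow_eq_one : σ ^ orderOf g = 1
  apply_mode : ∀ (v : V) (n : ℚ) (w : M), σ (ℳ.Y v n w) = ℳ.Y ((g : V ≃ₗ[ℂ] V) v) n (σ w)

/-- The component `M^r` of `M`: the eigenspace for `e^(2πir/K)` of an action `σ` of `g`. -/
def component (_ : TwistedModule 𝒱 g M) (σ : Module.End ℂ M) (r : ℤ) : Submodule ℂ M :=
  Module.End.eigenspace σ (Complex.exp (2 * Real.pi * Complex.I * r / (orderOf g : ℂ)))

/-- A subspace `W` of a `g`-twisted module that is stable under the operators `vₙ` with
`v ∈ V^0` is an untwisted `V^0`-module, by restriction. -/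
def restrictFixed (ℳ : TwistedModule 𝒱 g M) (W : Submodule ℂ M)
    (hW : ∀ v ∈ fixedSpace g, ∀ (n : ℚ), ∀ w ∈ W, ℳ.Y v n w ∈ W) :
    TwistedModule (𝒱.fixedPoints g) 1 W where
  Y :=
    { toFun := fun v n => (ℳ.Y v n).restrict (hW v v.2 n)
      map_add' := by intro a b; funext n; ext w; simp
      map_smul' := by intro c a; funext n; ext w; simp }
  grading := by
    rw [DirectSum.isInternal_submodule_iff_iSupIndep_and_iSup_eq_top]
    refine ⟨Module.End.eigenspaces_iSupIndep _, ?_⟩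
    exact iSup_eigenspace_restrict_eq_top (ℳ.Y 𝒱.ω 1) W (hW 𝒱.ω g.2.2.1 1)
      ((DirectSum.isInternal_submodule_iff_iSupIndep_and_iSup_eq_top _).1 ℳ.grading).2
  finite_dim lam := finiteDimensional_eigenspace_restrict (ℳ.Y 𝒱.ω 1) W
    (hW 𝒱.ω g.2.2.1 1) lam (ℳ.finite_dim lam)
  bounded_below lam := by
    obtain ⟨N, hN⟩ := ℳ.bounded_below lam
    exact ⟨N, fun n hn => eigenspace_restrict_bot (ℳ.Y 𝒱.ω 1) W
      (hW 𝒱.ω g.2.2.1 1) _ (hN n hn)⟩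
  mode_support r v _ n hn := by
    have h := ℳ.mode_support 0 v (fixedSpace_le_twistedPart g v.2) n (by
      rintro ⟨k, hk⟩
      exact hn ⟨k - r, by rw [hk]; simp⟩)
    ext w
    simp [h]
  truncation v w := by
    obtain ⟨N, hN⟩ := ℳ.truncation v w
    exact ⟨N, fun l hl => Subtype.ext (hN l hl)⟩
  vacuum n w := by
    apply Subtype.ext
    refine (ℳ.vacuum n w).trans ?_
    split_ifs <;> rfl
  jacobi r u _ v w p s t hs := by
    obtain ⟨k, hk⟩ := hs
    have h := ℳ.jacobi 0 u (fixedSpace_le_twistedPart g u.2) v w p s t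
      ⟨r + k, by rw [hk]; simp⟩
    apply Subtype.ext
    rw [coe_finsum_submodule, coe_finsum_submodule]
    have e : ∀ m : ℕ, (((𝒱.fixedPoints g).mode u (p + m) v : fixedSpace g) : V) =
        𝒱.mode u (p + m) v := fun m => coe_ncoeff_fixedY g u _ v
    simpa [e] using h
  virasoro m n w := by
    apply Subtype.ext
    exact ℳ.virasoro m n w
  derivative v n w := by
    apply Subtype.ext
    have e : (((𝒱.fixedPoints g).mode (𝒱.fixedPoints g).ω 0 v : fixedSpace g) : V) =
        𝒱.mode 𝒱.ω 0 v := coe_ncoeff_fixedY g _ _ v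
    have h := ℳ.derivative v n w
    rw [← e] at h
    exact h

/-- The component `M^r` as an untwisted `V^0`-module. -/
def componentModule (ℳ : TwistedModule 𝒱 g M) {σ : Module.End ℂ M}
    (hσ : ℳ.IsCompatibleAction σ) (r : ℤ) :
    TwistedModule (𝒱.fixedPoints g) 1 (ℳ.component σ r) :=
  ℳ.restrictFixed (ℳ.component σ r) (by
    intro v hv n w hw
    rw [component, Module.End.mem_eigenspace_iff] at *
    rw [hσ.apply_mode, mem_fixedSpace.1 hv, hw, map_smul])

end TwistedModule

end

/-!
Write `K` for the order of `g` and `V^r`, `M^r` for the eigenspaces of `g` with eigenvalue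
`e^(2πir/K)`. All consequences of the twisted Jacobi identity that are needed are obtained by
descending induction on the index of a mode.

* The vectors annihilated by all modes of a fixed `u` form a submodule of `M`, and the vectors of
  `V` acting as zero on `M` form an ideal. Since `M` and `V` are simple, `u ≠ 0` and `w ≠ 0` imply
  `uₙ w ≠ 0` for some `n` (`TwistedModule.exists_mode_ne_zero`).
* For a single `w ≠ 0` the vectors `vₙ w` span `M` (`TwistedModule.IsSimple.eq_top_of_mode_mem`).

A mode `vₙ` with `v ∈ V^r` shifts weights by an element of `-r/K + ℤ`, so the operator
`e^(2πi(λ - L(0)))` implements `g` on `M`. Its `K`-th power commutes with all modes and fixes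
`M_λ`, hence is `1` if `M_λ ≠ 0`. This is the required action, and it shows that all weights lie
in `λ + (1/K)ℤ`, where boundedness below on each of the `K` cosets of `ℤ` yields the minimal
weight.

Now let `g` act on `M` by any compatible `σ`. The set of `s` with `M^s ≠ 0` is stable under adding
`r` whenever `V^r ≠ 0`; since `g` has order exactly `K`, such `r` together with `K` generate `ℤ`,
and every `M^s` is nonzero. If `W ⊆ M^r` is a nonzero `V^0`-submodule and `0 ≠ w ∈ W`, then the
`vₙ w` span `M`, and among them only those with `v ∈ V^0` meet `M^r`; so `W = M^r`. Finally
`σ` is a multiple of `e^(2πi(λ - L(0)))` by Schur's lemma, so the weights of `M^r` modulo `ℤ`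
determine `r` modulo `K`; as the conformal vector lies in `V^0`, distinct components are not
isomorphic.
-/

noncomputable section

open VertexOperatorAlgebra

/-! ### Roots of unity and operators of finite order -/

/-- The root of unity `e^(2πir/K)`. -/
def rootOfUnity (K : ℕ) (r : ℤ) : ℂ :=
  Complex.exp (2 * Real.pi * Complex.I * r / (K : ℂ))

theorem rootOfUnity_ne_zero (K : ℕ) (r : ℤ) : rootOfUnity K r ≠ 0 := Complex.exp_ne_zero _

theorem rootOfUnity_add (K : ℕ) (r s : ℤ) :
    rootOfUnity K (r + s) = rootOfUnity K r * rootOfUnity K s := by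
  rw [rootOfUnity, rootOfUnity, rootOfUnity, ← Complex.exp_add]
  congr 1
  push_cast
  ring

theorem rootOfUnity_zero (K : ℕ) : rootOfUnity K 0 = 1 := by simp [rootOfUnity]

theorem rootOfUnity_neg (K : ℕ) (r : ℤ) : rootOfUnity K (-r) = (rootOfUnity K r)⁻¹ := by
  refine eq_inv_of_mul_eq_one_left ?_
  rw [← rootOfUnity_add, neg_add_cancel, rootOfUnity_zero]

theorem rootOfUnity_mul_nat (K : ℕ) (r : ℤ) (n : ℕ) :
    rootOfUnity K (r * n) = rootOfUnity K r ^ n := by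
  rw [rootOfUnity, rootOfUnity, ← Complex.exp_nat_mul]
  congr 1
  push_cast
  ring

theorem exp_two_pi_I_mul_eq_one_iff {x : ℂ} :
    Complex.exp (2 * Real.pi * Complex.I * x) = 1 ↔ ∃ n : ℤ, x = n := by
  rw [Complex.exp_eq_one_iff]
  refine exists_congr fun n => ?_
  rw [mul_comm (n : ℂ)]
  exact mul_right_inj' Complex.two_pi_I_ne_zero

theorem exp_two_pi_I_mul_eq_iff {x y : ℂ} :
    Complex.exp (2 * Real.pi * Complex.I * x) = Complex.exp (2 * Real.pi * Complex.I * y) ↔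
      ∃ n : ℤ, x = y + n := by
  rw [← div_eq_one_iff_eq (Complex.exp_ne_zero _), ← Complex.exp_sub, ← mul_sub,
    exp_two_pi_I_mul_eq_one_iff]
  exact exists_congr fun n => sub_eq_iff_eq_add'

theorem rootOfUnity_eq_one_iff {K : ℕ} (hK : 0 < K) {r : ℤ} :
    rootOfUnity K r = 1 ↔ (K : ℤ) ∣ r := by
  have hK' : (K : ℂ) ≠ 0 := Nat.cast_ne_zero.2 hK.ne'
  rw [rootOfUnity, mul_div_assoc, exp_two_pi_I_mul_eq_one_iff]
  refine exists_congr fun n => ?_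
  rw [div_eq_iff hK', mul_comm (n : ℂ)]
  exact_mod_cast Iff.rfl

theorem rootOfUnity_pow_self {K : ℕ} (hK : 0 < K) (r : ℤ) : rootOfUnity K r ^ K = 1 := by
  rw [← rootOfUnity_mul_nat, rootOfUnity_eq_one_iff hK]
  exact Dvd.intro_left r rfl

theorem rootOfUnity_eq_iff {K : ℕ} (hK : 0 < K) {r s : ℤ} :
    rootOfUnity K r = rootOfUnity K s ↔ (K : ℤ) ∣ r - s := by
  rw [← rootOfUnity_eq_one_iff hK, sub_eq_add_neg, rootOfUnity_add, rootOfUnity_neg,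
    ← div_eq_mul_inv, div_eq_one_iff_eq (rootOfUnity_ne_zero K s)]

theorem rootOfUnity_fin_injective {K : ℕ} (hK : 0 < K) :
    Function.Injective fun r : Fin K => rootOfUnity K ((r : ℕ) : ℤ) := by
  intro r s h
  have h1 := (rootOfUnity_eq_iff hK).1 h
  have h2 := Int.eq_zero_of_abs_lt_dvd h1 (by rw [abs_lt]; constructor <;> omega)
  exact Fin.ext (by omega)

/-- An operator of finite order on a complex vector space, possibly infinite-dimensional, is
diagonalizable: `∑ⱼ ζ^(-rj) fʲ` is, up to the factor `K`, the projection onto the eigenspace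
of `ζ^r`, and these projections sum to the identity. -/
theorem iSup_eigenspace_rootOfUnity {M : Type*} [AddCommGroup M] [Module ℂ M]
    {f : Module.End ℂ M} {K : ℕ} (hK : 0 < K) (hf : f ^ K = 1) :
    ⨆ r : Fin K, Module.End.eigenspace f (rootOfUnity K ((r : ℕ) : ℤ)) = ⊤ := by
  have hK' : (K : ℂ) ≠ 0 := Nat.cast_ne_zero.2 hK.ne'
  let P : Fin K → M → M := fun r x =>
    ∑ j ∈ Finset.range K, (rootOfUnity K (-(r : ℕ) : ℤ)) ^ j • (f ^ j) x
  have hP : ∀ (r : Fin K) (x : M),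
      P r x ∈ Module.End.eigenspace f (rootOfUnity K ((r : ℕ) : ℤ)) := by
    intro r x
    set ζ := rootOfUnity K (-(r : ℕ) : ℤ) with hζ
    have hinv : rootOfUnity K ((r : ℕ) : ℤ) * ζ = 1 := by
      rw [hζ, rootOfUnity_neg, mul_inv_cancel₀ (rootOfUnity_ne_zero _ _)]
    rw [Module.End.mem_eigenspace_iff]
    change f (∑ j ∈ Finset.range K, ζ ^ j • (f ^ j) x) =
      _ • ∑ j ∈ Finset.range K, ζ ^ j • (f ^ j) x
    have h1 : ∀ j, f (ζ ^ j • (f ^ j) x) =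
        rootOfUnity K ((r : ℕ) : ℤ) • (ζ ^ (j + 1) • (f ^ (j + 1)) x) := by
      intro j
      rw [map_smul, smul_smul, pow_succ ζ, mul_left_comm, hinv, mul_one, pow_succ' f]
      rfl
    rw [map_sum, Finset.sum_congr rfl fun j _ => h1 j, ← Finset.smul_sum]
    congr 1
    have h2 := Finset.sum_range_succ' (fun j => ζ ^ j • (f ^ j) x) K
    have h3 := Finset.sum_range_succ (fun j => ζ ^ j • (f ^ j) x) K
    rw [h2, hζ, rootOfUnity_pow_self hK, hf, pow_zero, pow_zero] at h3
    exact add_right_cancel h3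
  have hsum : ∀ x, ∑ r : Fin K, P r x = (K : ℂ) • x := by
    intro x
    rw [Finset.sum_comm]
    rw [Finset.sum_eq_single_of_mem 0 (Finset.mem_range.2 hK)]
    · simp [← Nat.cast_smul_eq_nsmul ℂ]
    · intro j hj hj0
      rw [← Finset.sum_smul]
      have hone : rootOfUnity K (-j : ℤ) ≠ 1 := by
        rw [Ne, rootOfUnity_eq_one_iff hK, dvd_neg]
        intro h
        exact absurd (Nat.le_of_dvd (Nat.pos_of_ne_zero hj0) (Int.natCast_dvd_natCast.1 h))
          (not_le.2 (Finset.mem_range.1 hj))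
      have h1 : ∀ r : Fin K, rootOfUnity K (-(r : ℕ) : ℤ) ^ j =
          rootOfUnity K (-j : ℤ) ^ (r : ℕ) := by
        intro r
        rw [← rootOfUnity_mul_nat, ← rootOfUnity_mul_nat]
        congr 1
        ring
      rw [Finset.sum_congr rfl fun r _ => h1 r,
        Fin.sum_univ_eq_sum_range (fun i => rootOfUnity K (-j : ℤ) ^ i), geom_sum_eq hone,
        rootOfUnity_pow_self hK, sub_self, zero_div, zero_smul]
  rw [eq_top_iff]
  intro x _
  rw [← inv_smul_smul₀ hK' x, ← hsum]
  exact Submodule.smul_mem _ _ (Submodule.sum_mem _ fun r _ => Submodule.mem_iSup_of_mem r (hP r x))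

/-- A subspace of an eigenspace is the whole eigenspace as soon as it spans everything together
with the other eigenspaces. -/
theorem eigenspace_le_of_sup_eq_top {M : Type*} [AddCommGroup M] [Module ℂ M]
    {f : Module.End ℂ M} {c : ℂ} {W : Submodule ℂ M} (hW : W ≤ Module.End.eigenspace f c)
    (h : W ⊔ ⨆ d, ⨆ _ : d ≠ c, Module.End.eigenspace f d = ⊤) :
    Module.End.eigenspace f c ≤ W := by
  intro x hx
  have hxt : x ∈ W ⊔ ⨆ d, ⨆ _ : d ≠ c, Module.End.eigenspace f d := h ▸ Submodule.mem_top
  obtain ⟨y, hy, z, hz, rfl⟩ := Submodule.mem_sup.1 hxt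
  have hz' : z ∈ Module.End.eigenspace f c := by
    simpa using Submodule.sub_mem _ hx (hW hy)
  have := Submodule.disjoint_def.1 (Module.End.eigenspaces_iSupIndep f c) z hz' hz
  rwa [this, add_zero]

/-! ### Finite sums and descending induction on modes -/

/-- Solving a finite relation for its leading term: this is the inductive step in all descending
inductions on modes. -/
theorem mem_of_finsum_mem {M : Type*} [AddCommGroup M] [Module ℂ M] {W : Submodule ℂ M}
    {f : ℕ → M} {N : ℕ} (hN : ∀ m, N ≤ m → f m = 0) (hsum : ∑ᶠ m, f m ∈ W)
    (h : ∀ m, 1 ≤ m → f m ∈ W) : f 0 ∈ W := by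
  rw [finsum_eq_sum_of_support_subset (s := Finset.range (N + 1)) f, Finset.sum_range_succ'] at hsum
  · exact (W.add_mem_iff_right (W.sum_mem fun m _ => h _ (Nat.le_add_left 1 m))).1 hsum
  · intro m hm
    by_contra hc
    exact hm (hN m (by simp at hc; omega))

theorem Submodule.finsum_mem_of_forall_mem {M : Type*} [AddCommGroup M] [Module ℂ M]
    (W : Submodule ℂ M) {f : ℕ → M} (h : ∀ m, f m ∈ W) : ∑ᶠ m, f m ∈ W :=
  finsum_induction (· ∈ W) W.zero_mem (fun _ _ => W.add_mem) h

/-- If `P` holds far to the right, and at `l` whenever it holds at `l + 1, l + 2, …`, then it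
holds everywhere. -/
theorem descending_induction {R : Type*} [Ring R] [LinearOrder R] [IsStrictOrderedRing R]
    [Archimedean R] {P : R → Prop} (N : R) (hN : ∀ l, N < l → P l)
    (h : ∀ l, (∀ m : ℕ, 1 ≤ m → P (l + m)) → P l) (l : R) : P l := by
  have key : ∀ n : ℕ, ∀ l : R, N < l + n → P l := by
    intro n
    induction n with
    | zero => intro l hl; exact hN l (by simpa using hl)
    | succ n ih =>
      intro l hl
      refine h l fun m hm => ih _ (hl.trans_le ?_)
      have : (1 : R) ≤ m := by exact_mod_cast hm
      push_cast
      rw [add_assoc, add_comm (m : R)]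
      gcongr
  obtain ⟨n, hn⟩ := exists_nat_gt (N - l)
  exact key n l (by rwa [sub_lt_iff_lt_add'] at hn)

/-! ### Homogeneous decompositions of a vertex operator algebra -/

namespace VertexOperatorAlgebra

variable {V : Type*} [AddCommGroup V] [Module ℂ V] {𝒱 : VertexOperatorAlgebra V}

theorem exists_mode_eq_zero (𝒱 : VertexOperatorAlgebra V) (u v : V) :
    ∃ N : ℤ, ∀ n, N < n → 𝒱.mode u n v = 0 :=
  ⟨-HahnSeries.order ((HahnModule.of ℂ).symm (𝒱.Y u v)) - 1, fun n hn =>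
    VertexOperator.ncoeff_eq_zero_of_lt_order _ _ _ (by omega)⟩

theorem mem_twistedPart {g : 𝒱.Aut} {r : ℤ} {v : V} :
    v ∈ twistedPart g r ↔ (g : V ≃ₗ[ℂ] V) v = rootOfUnity (orderOf g) r • v :=
  Module.End.mem_eigenspace_iff

theorem pow_apply_of_mem_twistedPart {g : 𝒱.Aut} {r : ℤ} {v : V} (hv : v ∈ twistedPart g r)
    (n : ℕ) : ((g ^ n : 𝒱.Aut) : V ≃ₗ[ℂ] V) v = rootOfUnity (orderOf g) r ^ n • v := by
  induction n with
  | zero => simp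
  | succ n ih =>
    rw [pow_succ', pow_succ, mul_comm]
    change (g : V ≃ₗ[ℂ] V) (((g ^ n : 𝒱.Aut) : V ≃ₗ[ℂ] V) v) = _
    rw [ih, map_smul, mem_twistedPart.1 hv, smul_smul, mul_comm]

theorem iSup_twistedPart {g : 𝒱.Aut} (hg : IsOfFinOrder g) :
    ⨆ r : ℤ, twistedPart g r = ⊤ := by
  have hpow : ((g : V ≃ₗ[ℂ] V) : Module.End ℂ V) ^ orderOf g = 1 := by
    have h1 : ∀ n : ℕ, ((g : V ≃ₗ[ℂ] V) : Module.End ℂ V) ^ n =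
        (((g ^ n : 𝒱.Aut) : V ≃ₗ[ℂ] V) : Module.End ℂ V) := by
      intro n
      induction n with
      | zero => rfl
      | succ n ih => rw [pow_succ, pow_succ, ih]; rfl
    rw [h1, pow_orderOf_eq_one]
    rfl
  rw [eq_top_iff, ← iSup_eigenspace_rootOfUnity hg.orderOf_pos hpow]
  exact iSup_le fun r => le_iSup (twistedPart g) ((r : ℕ) : ℤ)

theorem iSup_eigenspace_L0 (𝒱 : VertexOperatorAlgebra V) :
    ⨆ a : ℂ, Module.End.eigenspace (𝒱.mode 𝒱.ω 1) a = ⊤ := by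
  rw [eq_top_iff, ← ((DirectSum.isInternal_submodule_iff_iSupIndep_and_iSup_eq_top _).1
        𝒱.grading).2]
  exact iSup_le fun n => le_iSup (fun a : ℂ => Module.End.eigenspace (𝒱.mode 𝒱.ω 1) a) (n : ℂ)

theorem eigenspace_L0_eq_bot {a : ℂ} (ha : ∀ n : ℤ, a ≠ n) :
    Module.End.eigenspace (𝒱.mode 𝒱.ω 1) a = ⊥ := by
  have hV := ((DirectSum.isInternal_submodule_iff_iSupIndep_and_iSup_eq_top _).1 𝒱.grading).2
  rw [eq_bot_iff]
  refine (Module.End.eigenspaces_iSupIndep (𝒱.mode 𝒱.ω 1) a) le_rfl (le_trans le_top ?_)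
  rw [← hV]
  exact iSup_le fun n => le_iSup₂_of_le (n : ℂ) (ha n).symm le_rfl

/-- A linear condition that holds on all vectors homogeneous for both `g` and `L(0)` holds
on `V`. -/
theorem homogeneous_induction {g : 𝒱.Aut} (hg : IsOfFinOrder g) {S : Submodule ℂ V}
    (h : ∀ (r a : ℤ) (v : V), v ∈ twistedPart g r → 𝒱.mode 𝒱.ω 1 v = (a : ℂ) • v → v ∈ S) :
    S = ⊤ := by
  rw [eq_top_iff, ← iSup_twistedPart hg]
  refine iSup_le fun r => ?_
  have hstable : ∀ v ∈ twistedPart g r, 𝒱.mode 𝒱.ω 1 v ∈ twistedPart g r := by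
    intro v hv
    rw [mem_twistedPart] at *
    rw [g.2.2.2, g.2.2.1, hv, map_smul]
  have htop := iSup_eigenspace_restrict_eq_top (𝒱.mode 𝒱.ω 1) (twistedPart g r) hstable
    𝒱.iSup_eigenspace_L0
  have hle : (⊤ : Submodule ℂ (twistedPart g r)) ≤ S.comap (twistedPart g r).subtype := by
    rw [← htop]
    refine iSup_le fun a => ?_
    intro x hx
    have hx' := mem_eigenspace_restrict.1 hx
    by_cases ha : ∃ n : ℤ, a = n
    · obtain ⟨n, rfl⟩ := ha
      exact h r n x x.2 (Module.End.mem_eigenspace_iff.1 hx')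
    · rw [eigenspace_L0_eq_bot (by simpa using ha), Submodule.mem_bot] at hx'
      simp [hx']
  intro v hv
  exact hle (Submodule.mem_top (x := (⟨v, hv⟩ : twistedPart g r)))

end VertexOperatorAlgebra

/-! ### Consequences of the twisted Jacobi identity -/

namespace TwistedModule

variable {V : Type*} [AddCommGroup V] [Module ℂ V] {𝒱 : VertexOperatorAlgebra V} {g : 𝒱.Aut}
  {M : Type*} [AddCommGroup M] [Module ℂ M]

/-- To show that all `uₙ w` lie in a subspace it suffices to treat homogeneous `u` and the modes
that can occur for them. -/
theorem mode_mem_of_homogeneous (hg : IsOfFinOrder g) (ℳ : TwistedModule 𝒱 g M)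
    {W : Submodule ℂ M} {w : M}
    (h : ∀ (r a : ℤ) (v : V), v ∈ twistedPart g r → 𝒱.mode 𝒱.ω 1 v = (a : ℂ) • v →
      ∀ k : ℤ, ℳ.Y v (r / (orderOf g : ℚ) + k) w ∈ W) (u : V) (n : ℚ) : ℳ.Y u n w ∈ W := by
  let S : Submodule ℂ V :=
    W.comap ((LinearMap.applyₗ w).comp ((LinearMap.proj n).comp ℳ.Y))
  have hS : S = ⊤ := by
    refine homogeneous_induction hg fun r a v hv ha => ?_
    change ℳ.Y v n w ∈ W
    by_cases hn : ∃ k : ℤ, n = r / (orderOf g : ℚ) + k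
    · obtain ⟨k, rfl⟩ := hn
      exact h r a v hv ha k
    · rw [ℳ.mode_support r v hv n hn, LinearMap.zero_apply]
      exact W.zero_mem
  exact Submodule.eq_top_iff'.1 hS u

theorem IsSimple.eq_top {ℳ : TwistedModule 𝒱 g M} (hℳ : ℳ.IsSimple) {W : Submodule ℂ M}
    (hW : ∀ (u : V) (n : ℚ), ∀ w ∈ W, ℳ.Y u n w ∈ W) {w : M} (hw : w ∈ W) (hw0 : w ≠ 0) :
    W = ⊤ :=
  (hℳ.2 W hW).resolve_left fun h => hw0 (by rwa [h, Submodule.mem_bot] at hw)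

/-- `[L(0), vₙ] = (a - n - 1) vₙ` for `v` of weight `a`: the Jacobi identity for `u = ω` with
`p = 0` and `s = 1`, where both sums are over at most two terms. -/
theorem L0_mode (ℳ : TwistedModule 𝒱 g M) {v : V} {a : ℂ} (ha : 𝒱.mode 𝒱.ω 1 v = a • v)
    (n : ℚ) (w : M) :
    ℳ.Y 𝒱.ω 1 (ℳ.Y v n w) = ℳ.Y v n (ℳ.Y 𝒱.ω 1 w) + (a - n - 1) • ℳ.Y v n w := by
  have h := ℳ.jacobi 0 𝒱.ω (fixedSpace_le_twistedPart g g.2.2.1) v w 0 1 n ⟨1, by simp⟩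
  have hl : (Function.support fun m : ℕ => ((-1 : ℂ) ^ m * ((Ring.choose (0 : ℤ) m : ℤ) : ℂ)) •
      (ℳ.Y 𝒱.ω (((0 : ℤ) : ℚ) + 1 - m) (ℳ.Y v (n + m) w) - (-1 : ℂ) ^ (0 : ℤ) •
        ℳ.Y v (((0 : ℤ) : ℚ) + n - m) (ℳ.Y 𝒱.ω (1 + m) w))) ⊆ (Finset.range 1 : Set ℕ) := by
    intro m hm
    by_contra hc
    refine hm ?_
    have : m ≠ 0 := by simpa using hc
    simp [Ring.choose_zero_ite, this]
  have hr : (Function.support fun m : ℕ => ((Ring.choose (1 : ℚ) m : ℚ) : ℂ) •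
      ℳ.Y (𝒱.mode 𝒱.ω (0 + m) v) (1 + n - m) w) ⊆ (Finset.range 2 : Set ℕ) := by
    intro m hm
    by_contra hc
    refine hm ?_
    have : 1 < m := by simp at hc; omega
    have h1 : Ring.choose (1 : ℚ) m = 0 := by
      have := Ring.choose_natCast (R := ℚ) 1 m
      rw [Nat.choose_eq_zero_of_lt ‹1 < m›] at this
      simpa using this
    simp [h1]
  rw [finsum_eq_sum_of_support_subset _ hl, finsum_eq_sum_of_support_subset _ hr,
    Finset.sum_range_one, Finset.sum_range_succ, Finset.sum_range_one] at h
  have hd : ℳ.Y (𝒱.mode 𝒱.ω 0 v) (1 + n) w = (-(((1 + n : ℚ)) : ℂ)) • ℳ.Y v n w := by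
    rw [ℳ.derivative, add_sub_cancel_left]
  simp only [Nat.cast_zero, add_zero, sub_zero, Ring.choose_zero_right, Ring.choose_one_right,
    Nat.cast_one, zero_add, add_sub_cancel_left, Int.cast_zero, pow_zero, zpow_zero, one_smul,
    one_mul, Int.cast_one, Rat.cast_one, hd, ha, map_smul, Pi.smul_apply,
    LinearMap.smul_apply] at h
  rw [sub_eq_iff_eq_add] at h
  rw [h]
  push_cast
  module

/-- A mode of a vector of weight `a` shifts the `L(0)`-eigenvalue. -/
theorem mode_mem_wt (ℳ : TwistedModule 𝒱 g M) {v : V} {a : ℂ} (ha : 𝒱.mode 𝒱.ω 1 v = a • v)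
    (n : ℚ) {w : M} {mu : ℂ} (hw : w ∈ ℳ.wt mu) : ℳ.Y v n w ∈ ℳ.wt (mu + a - n - 1) := by
  rw [wt, Module.End.mem_eigenspace_iff] at *
  rw [ℳ.L0_mode ha, hw, map_smul]
  module

/-- The vectors annihilated by all modes of `u` form a submodule, by weak commutativity. -/
theorem mode_mode_eq_zero (hg : IsOfFinOrder g) (ℳ : TwistedModule 𝒱 g M) {u : V} {w : M}
    (hw : ∀ n, ℳ.Y u n w = 0) (a : V) (s t : ℚ) : ℳ.Y u t (ℳ.Y a s w) = 0 := by
  suffices h : ℳ.Y a s w ∈ LinearMap.ker (ℳ.Y u t) from h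
  revert a s
  refine ℳ.mode_mem_of_homogeneous hg fun r _ a ha _ k => ?_
  rw [LinearMap.mem_ker]
  obtain ⟨N, hN⟩ := ℳ.truncation a w
  refine descending_induction (P := fun k : ℤ => ∀ t : ℚ,
    ℳ.Y u t (ℳ.Y a (r / (orderOf g : ℚ) + k) w) = 0) ⌈N - r / (orderOf g : ℚ)⌉ ?_ ?_ k t
  · intro l hl t
    rw [hN, map_zero]
    have := (Int.le_ceil _).trans_lt (Int.cast_lt (R := ℚ).2 hl)
    linarith
  · intro k ih t
    obtain ⟨p, hp⟩ := 𝒱.exists_mode_eq_zero a u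
    -- With `a_(p+1+m) u = 0` for all `m` the iterate side of the Jacobi identity vanishes.
    have hj := ℳ.jacobi r a ha u w (p + 1) (r / (orderOf g : ℚ) + k) (t - (p + 1)) ⟨k, rfl⟩
    have e : ∀ m : ℕ, ((p + 1 : ℤ) : ℚ) + (t - (p + 1)) - m = t - m := by
      intro m
      push_cast
      ring
    have hrhs : ∀ m : ℕ, 𝒱.mode a (p + 1 + m) u = 0 := fun m => hp _ (by omega)
    simp only [hrhs, map_zero, Pi.zero_apply, LinearMap.zero_apply, smul_zero, finsum_zero, hw,
      zero_sub, e] at hj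
    have h0 := mem_of_finsum_mem (W := ⊥)
      (N := (⌈N - r / (orderOf g : ℚ)⌉ - k + 1).toNat) ?_
      ((Submodule.mem_bot ℂ).2 hj) ?_
    · rw [Submodule.mem_bot] at h0
      simp only [Nat.cast_zero, sub_zero, add_zero, pow_zero, Ring.choose_zero_right,
        Int.cast_one, one_mul, one_smul, neg_eq_zero] at h0
      exact (smul_eq_zero.1 h0).resolve_left (zpow_ne_zero _ (by norm_num))
    · intro m hm
      rw [hN, map_zero, smul_zero, neg_zero, smul_zero]
      have h1 : ⌈N - r / (orderOf g : ℚ)⌉ < k + m := by omega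
      have := (Int.le_ceil _).trans_lt (Int.cast_lt (R := ℚ).2 h1)
      push_cast at this
      linarith
    · intro m hm
      have := ih m hm (t - m)
      rw [Int.cast_add, Int.cast_natCast, ← add_assoc] at this
      rw [this, smul_zero, neg_zero, smul_zero]
      exact Submodule.zero_mem _

/-- The vectors of `V` all of whose modes vanish on `M` form an ideal of `V`. -/
theorem Y_mode_eq_zero (hg : IsOfFinOrder g) (ℳ : TwistedModule 𝒱 g M) {u : V}
    (hu : ℳ.Y u = 0) (a : V) (p : ℤ) : ℳ.Y (𝒱.mode a p u) = 0 := by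
  let S : Submodule ℂ V :=
    LinearMap.ker (ℳ.Y.comp (LinearMap.applyₗ u ∘ₗ LinearMap.proj p ∘ₗ VertexOperator.ncoeff
      ∘ₗ 𝒱.Y))
  have hS : S = ⊤ := by
    refine homogeneous_induction hg fun r _ a ha _ => ?_
    change ℳ.Y (𝒱.mode a p u) = 0
    obtain ⟨N, hN⟩ := 𝒱.exists_mode_eq_zero a u
    refine descending_induction (P := fun p : ℤ => ℳ.Y (𝒱.mode a p u) = 0) N ?_ ?_ p
    · intro l hl
      rw [hN l hl, map_zero]
    · intro p ih
      funext n
      ext w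
      have hj := ℳ.jacobi r a ha u w p (r / (orderOf g : ℚ)) (n - r / (orderOf g : ℚ))
        ⟨0, by simp⟩
      simp only [hu, map_zero, Pi.zero_apply, LinearMap.zero_apply, smul_zero, finsum_zero,
        sub_zero] at hj
      have h0 := mem_of_finsum_mem (W := ⊥) (N := (N - p + 1).toNat) ?_
        ((Submodule.mem_bot ℂ).2 hj.symm) ?_
      · rw [Submodule.mem_bot] at h0
        simpa using h0
      · intro m hm
        rw [hN _ (by omega)]
        simp
      · intro m hm
        rw [ih m hm]
        simp
  exact Submodule.eq_top_iff'.1 hS a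

/-- Over a simple vertex operator algebra a nonzero vector does not annihilate any nonzero
vector of a simple twisted module. -/
theorem exists_mode_ne_zero (h𝒱 : 𝒱.IsSimple) (hg : IsOfFinOrder g) {ℳ : TwistedModule 𝒱 g M}
    (hℳ : ℳ.IsSimple) {u : V} {w : M} (hu : u ≠ 0) (hw : w ≠ 0) : ∃ n, ℳ.Y u n w ≠ 0 := by
  by_contra! hc
  let W : Submodule ℂ M := ⨅ n, LinearMap.ker (ℳ.Y u n)
  have hW : W = ⊤ := by
    refine hℳ.eq_top (w := w) ?_ ?_ hw
    · intro a s x hx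
      simp only [W, Submodule.mem_iInf, LinearMap.mem_ker] at hx ⊢
      exact fun t => ℳ.mode_mode_eq_zero hg hx a s t
    · simpa only [W, Submodule.mem_iInf, LinearMap.mem_ker] using hc
  have hYu : ℳ.Y u = 0 := by
    funext n
    ext x
    have hx : x ∈ W := hW ▸ Submodule.mem_top
    simp only [W, Submodule.mem_iInf, LinearMap.mem_ker] at hx
    exact hx n
  have htop : LinearMap.ker ℳ.Y = ⊤ :=
    (h𝒱.2 (LinearMap.ker ℳ.Y) fun a p v hv => ℳ.Y_mode_eq_zero hg hv a p).resolve_left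
      fun h => hu ((Submodule.mem_bot ℂ).1 (h ▸ LinearMap.mem_ker.2 hYu))
  have hvac : ℳ.Y 𝒱.vac = 0 := by
    rw [← LinearMap.mem_ker, htop]
    exact Submodule.mem_top
  have := ℳ.vacuum (-1) w
  rw [hvac, if_pos rfl] at this
  exact hw this.symm

/-- The span of all `vₙ w`, for a fixed `w`, is a submodule, by associativity. -/
theorem mode_mode_mem_span (hg : IsOfFinOrder g) (ℳ : TwistedModule 𝒱 g M) {S : Submodule ℂ M}
    {w : M} (hS : ∀ v n, ℳ.Y v n w ∈ S) (u v : V) (a b : ℚ) : ℳ.Y u a (ℳ.Y v b w) ∈ S := by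
  refine ℳ.mode_mem_of_homogeneous hg (fun r _ u hu _ k => ?_) u a
  obtain ⟨Nu, hNu⟩ := ℳ.truncation u w
  obtain ⟨Nv, hNv⟩ := ℳ.truncation v w
  refine descending_induction (P := fun b : ℚ => ∀ k : ℤ,
    ℳ.Y u (r / (orderOf g : ℚ) + k) (ℳ.Y v b w) ∈ S) Nv ?_ ?_ b k
  · intro l hl k
    rw [hNv l hl, map_zero]
    exact S.zero_mem
  · intro b ih k
    -- For `s` large all `u_(s+m) w` vanish, which leaves one side of the associativity formula.
    obtain ⟨j, hj⟩ := exists_nat_gt (Nu - (r / (orderOf g : ℚ) + k))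
    have hu0 : ∀ m : ℕ, ℳ.Y u (r / (orderOf g : ℚ) + k + j + m) w = 0 := by
      intro m
      refine hNu _ ?_
      have : (0 : ℚ) ≤ m := m.cast_nonneg
      linarith
    have hjac := ℳ.jacobi r u hu v w (-j) (r / (orderOf g : ℚ) + k + j) b
      ⟨k + j, by push_cast; ring⟩
    have e : ∀ m : ℕ, (((-j : ℤ) : ℚ) + (r / (orderOf g : ℚ) + k + j) - m) =
        r / (orderOf g : ℚ) + ((k - m : ℤ) : ℚ) := by
      intro m
      push_cast
      ring
    simp only [hu0, map_zero, smul_zero, sub_zero, e] at hjac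
    have hmem := S.finsum_mem_of_forall_mem fun m : ℕ => S.smul_mem
      (((Ring.choose (r / (orderOf g : ℚ) + k + j) m : ℚ) : ℂ))
      (hS (𝒱.mode u (-j + m) v) (r / (orderOf g : ℚ) + k + j + b - m))
    rw [← hjac] at hmem
    have h0 := mem_of_finsum_mem (N := (⌈Nv - b⌉ + 1).toNat) ?_ hmem ?_
    · simpa using h0
    · intro m hm
      rw [hNv, map_zero, smul_zero]
      have h1 : ⌈Nv - b⌉ < (m : ℤ) := by omega
      have := (Int.le_ceil _).trans_lt (Int.cast_lt (R := ℚ).2 h1)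
      push_cast at this
      linarith
    · intro m hm
      exact S.smul_mem _ (ih m hm _)

/-- A subspace of a simple twisted module that contains all `vₙ w` for a single `w ≠ 0` is
everything. -/
theorem IsSimple.eq_top_of_mode_mem (hg : IsOfFinOrder g) {ℳ : TwistedModule 𝒱 g M}
    (hℳ : ℳ.IsSimple) {S : Submodule ℂ M} {w : M} (hw : w ≠ 0) (hS : ∀ v n, ℳ.Y v n w ∈ S) :
    S = ⊤ := by
  let T := Submodule.span ℂ (Set.range fun x : V × ℚ => ℳ.Y x.1 x.2 w)
  have hT : ∀ v n, ℳ.Y v n w ∈ T := fun v n => Submodule.subset_span ⟨(v, n), rfl⟩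
  have hTtop : T = ⊤ := by
    refine hℳ.eq_top (w := w) ?_ ?_ hw
    · intro u n x hx
      have hle : T ≤ T.comap (ℳ.Y u n) := by
        refine Submodule.span_le.2 ?_
        rintro _ ⟨⟨v, b⟩, rfl⟩
        exact ℳ.mode_mode_mem_span hg hT u v n b
      exact hle hx
    · have := hT 𝒱.vac (-1)
      rwa [ℳ.vacuum, if_pos rfl] at this
  rw [eq_top_iff, ← hTtop]
  refine Submodule.span_le.2 ?_
  rintro _ ⟨⟨v, b⟩, rfl⟩
  exact hS v b

end TwistedModule

/-! ### The operator `e^(2πi(λ - L(0)))` -/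

/-- A nonzero subspace stable under a diagonalizable operator contains an eigenvector. -/
theorem exists_eigenvector_mem {M : Type*} [AddCommGroup M] [Module ℂ M]
    {f : Module.End ℂ M} {W : Submodule ℂ M} (hW : ∀ x ∈ W, f x ∈ W)
    (hf : ⨆ c : ℂ, Module.End.eigenspace f c = ⊤) (hW0 : W ≠ ⊥) :
    ∃ c : ℂ, ∃ x ∈ W, x ≠ 0 ∧ f x = c • x := by
  by_contra! hc
  refine hW0 ((Submodule.eq_bot_iff W).2 fun x hx => ?_)
  have htop := iSup_eigenspace_restrict_eq_top f W hW hf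
  have hbot : ⨆ c : ℂ, Module.End.eigenspace (f.restrict hW) c = ⊥ := by
    refine iSup_eq_bot.2 fun c => (Submodule.eq_bot_iff _).2 fun y hy => ?_
    by_contra hy0
    exact hc c y y.2 (fun h => hy0 (Subtype.ext h))
      (Module.End.mem_eigenspace_iff.1 (mem_eigenspace_restrict.1 hy))
  have hx' : (⟨x, hx⟩ : W) ∈ (⊥ : Submodule ℂ W) := by
    rw [← hbot, htop]
    exact Submodule.mem_top
  exact congrArg Subtype.val ((Submodule.mem_bot ℂ).1 hx')

namespace TwistedModule

variable {V : Type*} [AddCommGroup V] [Module ℂ V] {𝒱 : VertexOperatorAlgebra V} {g : 𝒱.Aut}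
  {M : Type*} [AddCommGroup M] [Module ℂ M]

theorem iSup_wt (ℳ : TwistedModule 𝒱 g M) : ⨆ mu : ℂ, ℳ.wt mu = ⊤ :=
  ((DirectSum.isInternal_submodule_iff_iSupIndep_and_iSup_eq_top _).1 ℳ.grading).2

theorem bijective_coeLinearMap_wt (ℳ : TwistedModule 𝒱 g M) :
    Function.Bijective (DirectSum.coeLinearMap ℳ.wt) := ℳ.grading

/-- The operator `e^(2πi(λ - L(0)))`, which acts on `M_μ` as the scalar `e^(2πi(λ - μ))`. -/
def weightRotation (ℳ : TwistedModule 𝒱 g M) (lam : ℂ) : Module.End ℂ M :=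
  (DirectSum.toModule ℂ ℂ M fun mu =>
      Complex.exp (2 * Real.pi * Complex.I * (lam - mu)) • (ℳ.wt mu).subtype) ∘ₗ
    (LinearEquiv.ofBijective _ ℳ.bijective_coeLinearMap_wt).symm.toLinearMap

theorem weightRotation_apply (ℳ : TwistedModule 𝒱 g M) (lam : ℂ) {mu : ℂ} {x : M}
    (hx : x ∈ ℳ.wt mu) :
    ℳ.weightRotation lam x = Complex.exp (2 * Real.pi * Complex.I * (lam - mu)) • x := by
  have h : (LinearEquiv.ofBijective _ ℳ.bijective_coeLinearMap_wt).symm x =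
      DirectSum.lof ℂ ℂ (fun mu => ℳ.wt mu) mu ⟨x, hx⟩ := by
    rw [LinearEquiv.symm_apply_eq, LinearEquiv.ofBijective_apply, DirectSum.coeLinearMap_lof]
  rw [weightRotation, LinearMap.comp_apply, LinearEquiv.coe_coe, h, DirectSum.toModule_lof]
  rfl

/-- Conjugation by `e^(2πi(λ - L(0)))` implements `g`: a mode `vₙ` with `v ∈ V^r` changes
weights by `-r/K` modulo `ℤ`. -/
theorem weightRotation_mode (hg : IsOfFinOrder g) (ℳ : TwistedModule 𝒱 g M) (lam : ℂ) (v : V)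
    (n : ℚ) (w : M) :
    ℳ.weightRotation lam (ℳ.Y v n w) =
      ℳ.Y ((g : V ≃ₗ[ℂ] V) v) n (ℳ.weightRotation lam w) := by
  have hw : w ∈ ⨆ mu : ℂ, ℳ.wt mu := ℳ.iSup_wt ▸ Submodule.mem_top
  refine Submodule.iSup_induction (motive := fun w => ℳ.weightRotation lam (ℳ.Y v n w) =
    ℳ.Y ((g : V ≃ₗ[ℂ] V) v) n (ℳ.weightRotation lam w)) _ hw ?_ (by simp) ?_
  · intro mu x hx
    let S : Submodule ℂ V :=
      { carrier := {v | ℳ.weightRotation lam (ℳ.Y v n x) =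
          ℳ.Y ((g : V ≃ₗ[ℂ] V) v) n (ℳ.weightRotation lam x)}
        add_mem' := by
          intro a b ha hb
          simp only [Set.mem_ofPred_eq, map_add, Pi.add_apply, LinearMap.add_apply] at *
          rw [ha, hb]
        zero_mem' := by simp
        smul_mem' := by
          intro c a ha
          simp only [Set.mem_ofPred_eq, map_smul, Pi.smul_apply, LinearMap.smul_apply] at *
          rw [ha] }
    suffices hS : S = ⊤ from Submodule.eq_top_iff'.1 hS v
    refine homogeneous_induction hg fun r a v hv ha => ?_
    change ℳ.weightRotation lam (ℳ.Y v n x) =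
      ℳ.Y ((g : V ≃ₗ[ℂ] V) v) n (ℳ.weightRotation lam x)
    by_cases hn : ∃ k : ℤ, n = r / (orderOf g : ℚ) + k
    · obtain ⟨k, hk⟩ := hn
      rw [ℳ.weightRotation_apply lam (ℳ.mode_mem_wt ha n hx), ℳ.weightRotation_apply lam hx,
        mem_twistedPart.1 hv, map_smul, map_smul, Pi.smul_apply, LinearMap.smul_apply, smul_smul]
      congr 1
      rw [rootOfUnity, ← Complex.exp_add, mul_div_assoc, ← mul_add, exp_two_pi_I_mul_eq_iff]
      refine ⟨k + 1 - a, ?_⟩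
      rw [hk]
      push_cast
      ring
    · rw [mem_twistedPart.1 hv, map_smul, Pi.smul_apply, ℳ.mode_support r v hv n hn]
      simp
  · intro x y hx hy
    simp only [map_add]
    rw [hx, hy]

/-- The operator `e^(2πi(λ - L(0)))` has order dividing that of `g` when `λ` is a weight: its
`K`-th power commutes with all modes and fixes `M_λ`. -/
theorem isCompatibleAction_weightRotation (hg : IsOfFinOrder g) {ℳ : TwistedModule 𝒱 g M}
    (hℳ : ℳ.IsSimple) {lam : ℂ} (hlam : ℳ.wt lam ≠ ⊥) :
    ℳ.IsCompatibleAction (ℳ.weightRotation lam) where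
  apply_mode := ℳ.weightRotation_mode hg lam
  pow_eq_one := by
    set σ := ℳ.weightRotation lam
    have hpow : ∀ (j : ℕ) v n w, (σ ^ j) (ℳ.Y v n w) =
        ℳ.Y (((g ^ j : 𝒱.Aut) : V ≃ₗ[ℂ] V) v) n ((σ ^ j) w) := by
      intro j
      induction j with
      | zero => intro v n w; simp
      | succ j ih =>
        intro v n w
        rw [pow_succ', Module.End.mul_apply, ih, ℳ.weightRotation_mode hg lam, pow_succ']
        rfl
    obtain ⟨x, hx, hx0⟩ := Submodule.exists_mem_ne_zero_of_ne_bot hlam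
    have hfix : σ x = x := by
      rw [ℳ.weightRotation_apply lam hx, sub_self, mul_zero, Complex.exp_zero, one_smul]
    have htop : LinearMap.ker (σ ^ orderOf g - 1) = ⊤ := by
      refine hℳ.eq_top (w := x) ?_ ?_ hx0
      · intro u n w hw
        rw [LinearMap.mem_ker, LinearMap.sub_apply, Module.End.one_apply, sub_eq_zero] at *
        rw [hpow, hw, pow_orderOf_eq_one]
        rfl
      · rw [LinearMap.mem_ker, LinearMap.sub_apply, Module.End.one_apply, sub_eq_zero]
        have : ∀ j : ℕ, (σ ^ j) x = x := by
          intro j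
          induction j with
          | zero => simp
          | succ j ih => rw [pow_succ, Module.End.mul_apply, hfix, ih]
        exact this _
    exact sub_eq_zero.1 (LinearMap.ker_eq_top.1 htop)

theorem component_weightRotation (ℳ : TwistedModule 𝒱 g M) (lam : ℂ) (r : ℤ) :
    ℳ.component (ℳ.weightRotation lam) r =
      ⨆ n : ℤ, ℳ.wt (lam - (r : ℂ) / (orderOf g : ℂ) + (n : ℂ)) := by
  have hle : ∀ mu, ℳ.wt mu ≤ Module.End.eigenspace (ℳ.weightRotation lam)
      (Complex.exp (2 * Real.pi * Complex.I * (lam - mu))) := fun mu x hx =>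
    Module.End.mem_eigenspace_iff.2 (ℳ.weightRotation_apply lam hx)
  have hle' : ⨆ n : ℤ, ℳ.wt (lam - (r : ℂ) / (orderOf g : ℂ) + (n : ℂ)) ≤
      ℳ.component (ℳ.weightRotation lam) r := by
    refine iSup_le fun n => ?_
    have e := (exp_two_pi_I_mul_eq_iff (x := lam - (lam - (r : ℂ) / (orderOf g : ℂ) + n))
      (y := (r : ℂ) / (orderOf g : ℂ))).2 ⟨-n, by push_cast; ring⟩
    rw [component, mul_div_assoc, ← e]
    exact hle _
  refine le_antisymm (eigenspace_le_of_sup_eq_top hle' ?_) hle'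
  rw [eq_top_iff, ← ℳ.iSup_wt]
  refine iSup_le fun mu => ?_
  by_cases hmu : Complex.exp (2 * Real.pi * Complex.I * (lam - mu)) =
      Complex.exp (2 * Real.pi * Complex.I * (r : ℂ) / (orderOf g : ℂ))
  · rw [mul_div_assoc, exp_two_pi_I_mul_eq_iff] at hmu
    obtain ⟨n, hn⟩ := hmu
    refine le_sup_of_le_left (le_iSup_of_le (-n) (le_of_eq ?_))
    congr 1
    push_cast
    linear_combination -hn
  · exact le_sup_of_le_right (le_iSup₂_of_le _ hmu (hle mu))

/-! ### Weights -/

/-- The weights of a simple `g`-twisted module lie in a single coset of `(1/K)ℤ`. -/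
theorem exists_eq_add_div (hg : IsOfFinOrder g) {ℳ : TwistedModule 𝒱 g M}
    (hℳ : ℳ.IsSimple) {lam mu : ℂ} (hlam : ℳ.wt lam ≠ ⊥) (hmu : ℳ.wt mu ≠ ⊥) :
    ∃ k : ℤ, lam = mu + k / (orderOf g : ℂ) := by
  have hK : (orderOf g : ℂ) ≠ 0 := Nat.cast_ne_zero.2 hg.orderOf_pos.ne'
  have hpow := (isCompatibleAction_weightRotation hg hℳ hlam).pow_eq_one
  obtain ⟨x, hx, hx0⟩ := Submodule.exists_mem_ne_zero_of_ne_bot hmu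
  have hpowx : ∀ j : ℕ, (ℳ.weightRotation lam ^ j) x =
      Complex.exp (2 * Real.pi * Complex.I * (lam - mu)) ^ j • x := by
    intro j
    induction j with
    | zero => simp
    | succ j ih =>
      rw [pow_succ, Module.End.mul_apply, ℳ.weightRotation_apply lam hx, map_smul, ih, smul_smul,
        pow_succ']
  have h1 := hpowx (orderOf g)
  rw [hpow, Module.End.one_apply, ← Complex.exp_nat_mul, mul_left_comm] at h1
  have h2 : Complex.exp (2 * Real.pi * Complex.I * ((orderOf g : ℂ) * (lam - mu))) = 1 :=
    smul_left_injective ℂ hx0 (h1.symm.trans (one_smul ℂ x).symm)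
  obtain ⟨n, hn⟩ := exp_two_pi_I_mul_eq_one_iff.1 h2
  exact ⟨n, by rw [← hn, mul_div_cancel_left₀ _ hK]; ring⟩

theorem exists_wt_ne_bot {ℳ : TwistedModule 𝒱 g M} (hℳ : ℳ.IsSimple) : ∃ mu, ℳ.wt mu ≠ ⊥ := by
  have := hℳ.1
  by_contra! hc
  exact bot_ne_top ((iSup_eq_bot.2 hc).symm.trans ℳ.iSup_wt)

theorem existsUnique_isMinimalWeight (hg : IsOfFinOrder g) {ℳ : TwistedModule 𝒱 g M}
    (hℳ : ℳ.IsSimple) : ∃! lam : ℂ, ℳ.IsMinimalWeight lam := by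
  have hKpos := hg.orderOf_pos
  have hK : (orderOf g : ℂ) ≠ 0 := Nat.cast_ne_zero.2 hKpos.ne'
  obtain ⟨mu, hmu⟩ := exists_wt_ne_bot hℳ
  -- Each of the `K` cosets `μ + j/K + ℤ` has its own lower bound on the weights.
  choose N hN using fun j : Fin (orderOf g) =>
    ℳ.bounded_below (mu + ((j : ℕ) : ℂ) / (orderOf g : ℂ))
  obtain ⟨L, hL⟩ := (Set.finite_range N).bddBelow
  obtain ⟨k, hk, hkmin⟩ := Int.exists_least_of_bdd
    (P := fun k : ℤ => ℳ.wt (mu + (k : ℂ) / (orderOf g : ℂ)) ≠ ⊥)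
    ⟨orderOf g * L, fun z hz => by
      by_contra! hlt
      have hKz : (0 : ℤ) < orderOf g := by exact_mod_cast hKpos
      have hmod0 := Int.emod_nonneg z hKz.ne'
      have hmod1 := Int.emod_lt_of_pos z hKz
      have hdiv : z / (orderOf g : ℤ) < L := Int.ediv_lt_of_lt_mul hKz (by rwa [mul_comm])
      let j : Fin (orderOf g) := ⟨(z % (orderOf g : ℤ)).toNat, by omega⟩
      have hj : (((j : ℕ) : ℤ)) = z % (orderOf g : ℤ) := Int.toNat_of_nonneg hmod0
      refine hz ?_
      have := hN j (z / (orderOf g : ℤ)) (hdiv.trans_le (hL ⟨j, rfl⟩))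
      have hz' : (z : ℂ) = (j : ℕ) + (orderOf g : ℂ) * ((z / (orderOf g : ℤ) : ℤ) : ℂ) := by
        have h := Int.emod_add_mul_ediv z (orderOf g : ℤ)
        rw [← hj] at h
        exact_mod_cast h.symm
      rw [hz', add_div, mul_div_cancel_left₀ _ hK, ← add_assoc]
      exact this⟩
    ⟨0, by simpa using hmu⟩
  refine ⟨mu + (k : ℂ) / (orderOf g : ℂ), ⟨hk, fun n hn => ?_⟩, ?_⟩
  · by_contra hne
    have := hkmin (k - n) (by
      convert hne using 2
      push_cast
      ring)
    omega
  · intro nu hnu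
    obtain ⟨j, hj⟩ := exists_eq_add_div hg hℳ hnu.1 hmu
    have hle := hkmin j (hj ▸ hnu.1)
    obtain ⟨d, hd⟩ := Int.le.dest hle
    rcases Nat.eq_zero_or_pos d with rfl | hdpos
    · rw [hj, ← hd]
      simp
    · refine absurd (hnu.2 d hdpos) ?_
      convert hk using 3
      rw [hj, ← hd]
      push_cast
      ring

/-! ### Compatible actions -/

theorem component_eq_eigenspace (ℳ : TwistedModule 𝒱 g M) (σ : Module.End ℂ M) (r : ℤ) :
    ℳ.component σ r = Module.End.eigenspace σ (rootOfUnity (orderOf g) r) := rfl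

theorem mem_component {ℳ : TwistedModule 𝒱 g M} {σ : Module.End ℂ M} {r : ℤ} {x : M} :
    x ∈ ℳ.component σ r ↔ σ x = rootOfUnity (orderOf g) r • x :=
  Module.End.mem_eigenspace_iff

namespace IsCompatibleAction

variable {ℳ : TwistedModule 𝒱 g M} {σ : Module.End ℂ M}

theorem iSup_component (hg : IsOfFinOrder g) (hσ : ℳ.IsCompatibleAction σ) :
    ⨆ r : Fin (orderOf g), ℳ.component σ ((r : ℕ) : ℤ) = ⊤ :=
  iSup_eigenspace_rootOfUnity hg.orderOf_pos hσ.pow_eq_one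

theorem isInternal_component (hg : IsOfFinOrder g) (hσ : ℳ.IsCompatibleAction σ) :
    DirectSum.IsInternal fun r : Fin (orderOf g) => ℳ.component σ ((r : ℕ) : ℤ) := by
  rw [DirectSum.isInternal_submodule_iff_iSupIndep_and_iSup_eq_top]
  exact ⟨(Module.End.eigenspaces_iSupIndep σ).comp (rootOfUnity_fin_injective hg.orderOf_pos),
    hσ.iSup_component hg⟩

theorem mode_mem_component (hσ : ℳ.IsCompatibleAction σ) {r s : ℤ} {v : V} {x : M}
    (hv : v ∈ twistedPart g r) (hx : x ∈ ℳ.component σ s) (n : ℚ) :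
    ℳ.Y v n x ∈ ℳ.component σ (r + s) := by
  rw [mem_component] at *
  rw [hσ.apply_mode, mem_twistedPart.1 hv, hx, map_smul, map_smul, Pi.smul_apply,
    LinearMap.smul_apply, smul_smul, rootOfUnity_add, mul_comm]

/-- A form of Schur's lemma: two compatible actions that are proportional on one nonzero vector
are proportional. -/
theorem eq_smul (hℳ : ℳ.IsSimple) {τ : Module.End ℂ M} (hσ : ℳ.IsCompatibleAction σ)
    (hτ : ℳ.IsCompatibleAction τ) {c : ℂ} {x : M} (hx0 : x ≠ 0) (hx : σ x = c • τ x) :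
    σ = c • τ := by
  refine sub_eq_zero.1 (LinearMap.ker_eq_top.1 (hℳ.eq_top (w := x) ?_ ?_ hx0))
  · intro u n w hw
    rw [LinearMap.mem_ker, LinearMap.sub_apply, LinearMap.smul_apply, sub_eq_zero] at *
    rw [hσ.apply_mode, hτ.apply_mode, hw, map_smul]
  · rw [LinearMap.mem_ker, LinearMap.sub_apply, LinearMap.smul_apply, hx, sub_self]

/-- Every compatible action is a multiple of `e^(2πi(λ - L(0)))`. -/
theorem exists_eq_smul_weightRotation (hg : IsOfFinOrder g) (hℳ : ℳ.IsSimple)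
    (hσ : ℳ.IsCompatibleAction σ) {lam : ℂ} (hlam : ℳ.wt lam ≠ ⊥) :
    ∃ c : ℂ, σ = c • ℳ.weightRotation lam := by
  have hstable : ∀ x ∈ ℳ.wt lam, σ x ∈ ℳ.wt lam := by
    intro x hx
    rw [wt, Module.End.mem_eigenspace_iff] at *
    have h := hσ.apply_mode 𝒱.ω 1 x
    rw [g.2.2.1, hx, map_smul] at h
    exact h.symm
  have hdiag : ⨆ c : ℂ, Module.End.eigenspace σ c = ⊤ := by
    rw [eq_top_iff, ← hσ.iSup_component hg]
    exact iSup_le fun r => le_iSup (Module.End.eigenspace σ) (rootOfUnity (orderOf g) (r : ℕ))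
  obtain ⟨c, x, hx, hx0, hc⟩ := exists_eigenvector_mem hstable hdiag hlam
  refine ⟨c, hσ.eq_smul hℳ (isCompatibleAction_weightRotation hg hℳ hlam) hx0 ?_⟩
  rw [hc, ℳ.weightRotation_apply lam hx, sub_self, mul_zero, Complex.exp_zero, one_smul]

/-- All components are nonzero: the `h` for which `s ↦ s + h` preserves `{s | M^s ≠ 0}` form a
subgroup `dℤ` of `ℤ` with `d ∣ K`, it contains every `r` with `V^r ≠ 0`, and so `g^(K/d) = 1`. -/
theorem component_ne_bot (h𝒱 : 𝒱.IsSimple) (hg : IsOfFinOrder g) (hℳ : ℳ.IsSimple)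
    (hσ : ℳ.IsCompatibleAction σ) (s : ℤ) : ℳ.component σ s ≠ ⊥ := by
  have hKpos := hg.orderOf_pos
  have := hℳ.1
  have hperiod : ∀ s j : ℤ, ℳ.component σ (s + orderOf g * j) = ℳ.component σ s := by
    intro s j
    rw [component_eq_eigenspace, component_eq_eigenspace, rootOfUnity_add,
      (rootOfUnity_eq_one_iff hKpos).2 (Dvd.intro j rfl), mul_one]
  have hadd : ∀ r s : ℤ, twistedPart g r ≠ ⊥ → ℳ.component σ s ≠ ⊥ →
      ℳ.component σ (s + r) ≠ ⊥ := by
    intro r s hr hs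
    obtain ⟨v, hv, hv0⟩ := Submodule.exists_mem_ne_zero_of_ne_bot hr
    obtain ⟨x, hx, hx0⟩ := Submodule.exists_mem_ne_zero_of_ne_bot hs
    obtain ⟨n, hn⟩ := exists_mode_ne_zero h𝒱 hg hℳ hv0 hx0
    have hmem := hσ.mode_mem_component hv hx n
    rw [add_comm] at hmem
    exact Submodule.ne_bot_iff _ |>.2 ⟨_, hmem, hn⟩
  let H : AddSubgroup ℤ :=
    { carrier := {h | ∀ s, ℳ.component σ s ≠ ⊥ ↔ ℳ.component σ (s + h) ≠ ⊥}
      add_mem' := fun {a b} ha hb s => by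
        rw [ha, hb, add_assoc]
      zero_mem' := fun s => by rw [add_zero]
      neg_mem' := fun {a} ha s => by
        rw [ha (s + -a), neg_add_cancel_right] }
  have hH : ∀ r, twistedPart g r ≠ ⊥ → r ∈ H := by
    intro r hr s
    refine ⟨hadd r s hr, fun h => ?_⟩
    -- Adding `r` another `K - 1` times returns to `s`.
    have hmul : ∀ n : ℕ, ℳ.component σ (s + r + n * r) ≠ ⊥ := by
      intro n
      induction n with
      | zero => simpa using h
      | succ n ih =>
        have := hadd r _ hr ih
        convert this using 2
        push_cast
        ring
    have h1 := hmul (orderOf g - 1)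
    rw [← hperiod s r]
    convert h1 using 2
    rw [Nat.cast_sub hKpos]
    push_cast
    ring
  have hKH : (orderOf g : ℤ) ∈ H := fun s => by
    rw [← hperiod s 1, mul_one]
  -- With `H = dℤ` and `K = |d| e`, the power `g^e` fixes every nonzero `V^r`.
  obtain ⟨d, hd⟩ := Int.subgroup_cyclic H
  have hmemd : ∀ r, r ∈ H ↔ d ∣ r := by
    intro r
    rw [hd, ← AddSubgroup.zmultiples_eq_closure, Int.mem_zmultiples_iff]
  obtain ⟨e, he⟩ := Int.natAbs_dvd_natAbs.2 ((hmemd _).1 hKH)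
  rw [Int.natAbs_natCast] at he
  have hge : g ^ e = 1 := by
    apply Subtype.ext
    apply LinearEquiv.ext
    intro v
    have hle : (⊤ : Submodule ℂ V) ≤
        LinearMap.eqLocus (((g ^ e : 𝒱.Aut) : V ≃ₗ[ℂ] V) : Module.End ℂ V) 1 := by
      rw [← iSup_twistedPart hg]
      refine iSup_le fun r x hx => ?_
      rw [LinearMap.mem_eqLocus]
      change ((g ^ e : 𝒱.Aut) : V ≃ₗ[ℂ] V) x = x
      by_cases hx0 : x = 0
      · rw [hx0, map_zero]
      · have hr : d ∣ r := (hmemd r).1 (hH r (Submodule.ne_bot_iff _ |>.2 ⟨x, hx, hx0⟩))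
        rw [pow_apply_of_mem_twistedPart hx, ← rootOfUnity_mul_nat,
          (rootOfUnity_eq_one_iff hKpos).2, one_smul]
        rw [he]
        rw [Nat.cast_mul]
        exact mul_dvd_mul (Int.natAbs_dvd.2 hr) dvd_rfl
    exact hle (Submodule.mem_top (x := v))
  have hdvd : orderOf g ∣ e := orderOf_dvd_of_pow_eq_one hge
  have hepos : 0 < e := Nat.pos_of_ne_zero fun h => hKpos.ne' (by rw [he, h, mul_zero])
  have hd1 : d.natAbs = 1 := by
    have h1 := Nat.le_of_dvd hepos hdvd
    rw [he] at h1
    have h2 : d.natAbs ≤ 1 := Nat.le_of_mul_le_mul_right (by simpa using h1) hepos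
    have h3 : d.natAbs ≠ 0 := fun h => by rw [h, zero_mul] at he; omega
    omega
  have hall : ∀ r, r ∈ H := fun r => (hmemd r).2 (Int.natAbs_dvd.1 (by rw [hd1]; simp))
  by_contra hbot
  have hnone : ∀ s', ℳ.component σ s' = ⊥ := by
    intro s'
    by_contra hs'
    have := (hall (s - s') s').1 hs'
    rw [add_sub_cancel] at this
    exact this hbot
  have htop := hσ.iSup_component hg
  simp only [hnone, iSup_bot] at htop
  exact bot_ne_top htop

/-- For `0 ≠ w ∈ M^r` the vectors `vₙ w` span `M`; those with `v ∈ V^0` account for all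
of `M^r`, the others lie in other components. -/
theorem component_le_of_stable (hg : IsOfFinOrder g) (hℳ : ℳ.IsSimple)
    (hσ : ℳ.IsCompatibleAction σ) {r : ℤ} {W : Submodule ℂ M} (hWr : W ≤ ℳ.component σ r)
    (hW : ∀ v ∈ fixedSpace g, ∀ n : ℚ, ∀ w ∈ W, ℳ.Y v n w ∈ W) (hW0 : W ≠ ⊥) :
    ℳ.component σ r ≤ W := by
  obtain ⟨w, hw, hw0⟩ := Submodule.exists_mem_ne_zero_of_ne_bot hW0
  refine eigenspace_le_of_sup_eq_top hWr (hℳ.eq_top_of_mode_mem hg hw0 fun v n => ?_)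
  refine ℳ.mode_mem_of_homogeneous hg (fun t _ v hv _ k => ?_) v n
  by_cases ht : rootOfUnity (orderOf g) t = 1
  · refine Submodule.mem_sup_left (hW v ?_ _ w hw)
    rw [mem_fixedSpace, mem_twistedPart.1 hv, ht, one_smul]
  · refine Submodule.mem_sup_right (Submodule.mem_iSup_of_mem (rootOfUnity (orderOf g) (t + r))
      (Submodule.mem_iSup_of_mem ?_ (hσ.mode_mem_component hv (hWr hw) _)))
    rw [rootOfUnity_add]
    exact fun h => ht ((mul_eq_right₀ (rootOfUnity_ne_zero _ _)).1 h)

theorem isSimple_componentModule (h𝒱 : 𝒱.IsSimple) (hg : IsOfFinOrder g) (hℳ : ℳ.IsSimple)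
    (hσ : ℳ.IsCompatibleAction σ) (r : ℤ) : (ℳ.componentModule hσ r).IsSimple := by
  refine ⟨Submodule.nontrivial_iff_ne_bot.2 (hσ.component_ne_bot h𝒱 hg hℳ r), fun W hW => ?_⟩
  refine or_iff_not_imp_left.2 fun hW0 => ?_
  have hle := hσ.component_le_of_stable hg hℳ (W := W.map (ℳ.component σ r).subtype)
    (Submodule.map_subtype_le _ _) ?_ ?_
  · rw [Submodule.eq_top_iff']
    intro x
    obtain ⟨y, hy, hyx⟩ := hle x.2
    rwa [← Subtype.ext hyx]
  · rintro v hv n _ ⟨y, hy, rfl⟩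
    exact ⟨_, hW ⟨v, hv⟩ n y hy, rfl⟩
  · exact fun h => hW0 (Submodule.map_injective_of_injective (Submodule.injective_subtype _)
      (h.trans (Submodule.map_bot _).symm))

/-- Isomorphic components are equal, because the weights of `M^r` determine `r` modulo `K`. -/
theorem eq_of_isomorphic (h𝒱 : 𝒱.IsSimple) (hg : IsOfFinOrder g) (hℳ : ℳ.IsSimple)
    (hσ : ℳ.IsCompatibleAction σ) {r s : ℤ}
    (h : (ℳ.componentModule hσ r).Isomorphic (ℳ.componentModule hσ s)) :
    rootOfUnity (orderOf g) r = rootOfUnity (orderOf g) s := by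
  obtain ⟨φ, hφ⟩ := h
  obtain ⟨lam, hlam⟩ := exists_wt_ne_bot hℳ
  obtain ⟨c, hc⟩ := hσ.exists_eq_smul_weightRotation hg hℳ hlam
  have hstable : ∀ x ∈ ℳ.component σ r, ℳ.Y 𝒱.ω 1 x ∈ ℳ.component σ r := by
    intro x hx
    have := hσ.mode_mem_component (fixedSpace_le_twistedPart g g.2.2.1) hx 1
    rwa [zero_add] at this
  obtain ⟨nu, x, hx, hx0, hxnu⟩ := exists_eigenvector_mem hstable ℳ.iSup_wt
    (hσ.component_ne_bot h𝒱 hg hℳ r)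
  have key : ∀ (t : ℤ) (y : M), y ∈ ℳ.component σ t → y ≠ 0 → ℳ.Y 𝒱.ω 1 y = nu • y →
      rootOfUnity (orderOf g) t =
        c * Complex.exp (2 * Real.pi * Complex.I * (lam - nu)) := by
    intro t y hy hy0 hynu
    rw [mem_component, hc, LinearMap.smul_apply,
      ℳ.weightRotation_apply lam (Module.End.mem_eigenspace_iff.2 hynu), smul_smul] at hy
    exact smul_left_injective ℂ hy0 hy.symm
  rw [key r x hx hx0 hxnu]
  refine (key s (φ ⟨x, hx⟩ : ℳ.component σ s) (φ ⟨x, hx⟩).2 ?_ ?_).symm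
  · intro h0
    exact hx0 (congrArg Subtype.val (φ.map_eq_zero_iff.1 (Subtype.ext h0)))
  · have h1 := hφ ⟨𝒱.ω, g.2.2.1⟩ 1 ⟨x, hx⟩
    have h2 : (ℳ.componentModule hσ r).Y ⟨𝒱.ω, g.2.2.1⟩ 1 ⟨x, hx⟩ =
        nu • (⟨x, hx⟩ : ℳ.component σ r) := Subtype.ext hxnu
    rw [h2, map_smul] at h1
    exact (congrArg Subtype.val h1).symm

end IsCompatibleAction

end TwistedModule

end

theorem mainTheorem4 {V : Type*} [AddCommGroup V] [Module ℂ V]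
    (𝒱 : VertexOperatorAlgebra V) (h𝒱 : 𝒱.IsSimple)
    (g : 𝒱.Aut) (hg : IsOfFinOrder g)
    {M : Type*} [AddCommGroup M] [Module ℂ M]
    (ℳ : TwistedModule 𝒱 g M) (hℳ : ℳ.IsSimple) :
    (∃! lam : ℂ, ℳ.IsMinimalWeight lam) ∧
    (∀ lam : ℂ, ℳ.IsMinimalWeight lam →
      ∃! σ : Module.End ℂ M, ℳ.IsCompatibleAction σ ∧
        ∀ r : ℤ, ℳ.component σ r =
          ⨆ n : ℤ, ℳ.wt (lam - (r : ℂ) / (orderOf g : ℂ) + (n : ℂ))) ∧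
    (∀ (σ : Module.End ℂ M) (hσ : ℳ.IsCompatibleAction σ),
      (DirectSum.IsInternal fun r : Fin (orderOf g) => ℳ.component σ ((r : ℕ) : ℤ)) ∧
      (∀ r : Fin (orderOf g), ℳ.component σ ((r : ℕ) : ℤ) ≠ ⊥) ∧
      (∀ r : Fin (orderOf g), (ℳ.componentModule hσ ((r : ℕ) : ℤ)).IsSimple) ∧
      (∀ r s : Fin (orderOf g), r ≠ s →
        ¬ (ℳ.componentModule hσ ((r : ℕ) : ℤ)).Isomorphic
            (ℳ.componentModule hσ ((s : ℕ) : ℤ)))) := by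
  refine ⟨TwistedModule.existsUnique_isMinimalWeight hg hℳ, fun lam hlam => ?_,
    fun σ hσ => ⟨hσ.isInternal_component hg, fun r => hσ.component_ne_bot h𝒱 hg hℳ _,
      fun r => hσ.isSimple_componentModule h𝒱 hg hℳ _, fun r s hrs hiso => hrs
        (rootOfUnity_fin_injective hg.orderOf_pos (hσ.eq_of_isomorphic h𝒱 hg hℳ hiso))⟩⟩
  refine ⟨ℳ.weightRotation lam, ⟨TwistedModule.isCompatibleAction_weightRotation hg hℳ hlam.1,
    ℳ.component_weightRotation lam⟩, fun σ hσ => ?_⟩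
  -- Both operators act by the same scalar on each component, and the components span `M`.
  have hle : (⊤ : Submodule ℂ M) ≤ LinearMap.eqLocus σ (ℳ.weightRotation lam) := by
    rw [← hσ.1.iSup_component hg]
    refine iSup_le fun r x hx => ?_
    have hx' := hx
    rw [hσ.2, ← ℳ.component_weightRotation lam] at hx'
    exact (TwistedModule.mem_component.1 hx).trans (TwistedModule.mem_component.1 hx').symm
  exact LinearMap.ext fun x => hle (Submodule.mem_top (x := x))
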